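/- Let $n\ge 1$, let $H^{(n)}=L^2(S^1,\mathbb C^n)$, and let $H^{(n)}_+$ (resp. $H^{(n)}_-$) be the closed span of the vectors $z^k e_\alpha$ with $k\ge 0$ (resp. $k<0$), $\alpha=1,\dots,n$. Let $W\in \mathrm{Gr}^{(n)}$, i.e. $W\subseteq H^{(n)}$ is a closed subspace with $zW\subseteq W$ for which the orthogonal projection $\mathrm{pr}_+:W\to H^{(n)}_+$ is Fredholm and $\mathrm{pr}_-:W\to H^{(n)}_-$ is Hilbert–Schmidt, and suppose that $W$ lies in the big cell, i.e. $\mathrm{pr}_+:W\to H^{(n)}_+$ is bijective. Call $w_1,\dots,w_n\in W$ a normalized frame if the matrix with columns $w_1,\dots,w_n$ is the sum of a constant upper triangular matrix with ones on the diagonal and a series in strictly negative powers of $z$. For a normalized frame put $\omega_{ns+j}(z)=z^{ns}\sum_{i=1}^n z^{i-1}(w_j)_i(z^n)$ ($s\ge 0$, $1\le j\le n$), let $t=(t_1,t_2,\dots)$, $\xi(t,z)=\sum_{i\ge1}t_iz^i$, $D=\partial/\partial t_1$, and define, as formal power series in $t$ and formal pseudo-differential operators over them, $$\tau_{W,N}=\det\Big[\tfrac1{2\pi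 i}\oint z^{-i}e^{\xi(t,z)}\omega_j(z)\,dz\Big]_{1\le i,j\le nN},\qquad f_{s,N}=\tfrac1{2\pi i}\oint z^{-nN}e^{\xi(t,z)}\omega_s(z)\,dz,$$ $$\Delta_{W,N}(f)=\frac{\mathrm{Wr}(f,f_{1,N},\dots,f_{nN,N})}{\mathrm{Wr}(f_{1,N},\dots,f_{nN,N})},\quad S_{W,N}=\Delta_{W,N}D^{-nN},\quad \psi_{W,N}=S_{W,N}e^{\xi(t,z)},\quad \mathcal L_{W,N}=S_{W,N}DS_{W,N}^{-1},$$ where $\mathrm{Wr}(g_1,\dots,g_M)=\det[D^{M-j}g_i]_{1\le i,j\le M}$. Give $t_m$ degree $m$; a stable limit of series is a limit in which, for every $Q$, all terms of degree at most $Q$ are eventually constant, and stable limits of operators and of wave functions are taken coefficientwise in $D^k$, resp. in $z^k$ after factoring out $e^{\xi(t,z)}$. Then normalized frames of $W$ exist, and for $N\to\infty$ the stable limits $\tau_W,S_W,\psi_W,\mathcal L_W,L_W$ of $\tau_{W,N}$, $S_{W,N}$, $\psi_{W,N}$, $\mathcal L_{W,N}$, $\mathcal L_{W,N}^n$ exist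 and do not depend on the normalized frame. Moreover $S_W=1+O(D^{-1})$ is invertible, $\psi_W=S_We^{\xi}$, $\mathcal L_W=S_WDS_W^{-1}$ solves the KP hierarchy $\partial\mathcal L_W/\partial t_j=[(\mathcal L_W^j)_+,\mathcal L_W]$ ($j\ge1$), $L_W=\mathcal L_W^n$, and $\tau_W,\psi_W,L_W$ are the $\tau$-function, the wave function and the differential operator of order $n$ of a solution of the $n$-th Gelfand–Dickey hierarchy: 1. $L_W=(L_W)_+=D^n+u_{n-2}D^{n-2}+\dots+u_0$, $\ \partial L_W/\partial t_j=[(L_W^{j/n})_+,L_W]$ for all $j\ge1$ with $L_W^{1/n}=\mathcal L_W$, and $L_W$ does not depend on the times $t_{nk}$, $k\ge1$; 2. $\psi_W=e^{\xi(t,z)}(1+O(z^{-1}))$, $\ L_W\psi_W=z^n\psi_W$, and $\partial\psi_W/\partial t_j=(\mathcal L_W^j)_+\psi_W$ for all $j\ge 1$; 3. $\tau_W$ has nonzero constant term and $\psi_W(t;z)=e^{\xi(t,z)}\,\tau_W\big(t_1-\tfrac1z,\,t_2-\tfrac1{2z^2},\,t_3-\tfrac1{3z^3},\dots\big)/\tau_W(t)$.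 -/

import Mathlib

namespace GelfandDickey

open MeasureTheory AddCircle

noncomputable section

/-! ### The Hilbert space `L²(S¹, ℂⁿ)` and its Grassmannian

The circle is `ℝ/ℤ`, with `z = exp (2πiθ)`, so that `z ^ k` is `fourier k`. -/

/-- `H n = L²(S¹, ℂⁿ)`. -/
abbrev H (n : ℕ) : Type :=
  Lp (EuclideanSpace ℂ (Fin n)) 2 (haarAddCircle : Measure UnitAddCircle)

/-- The basis vector `e_{α,k} = (0, …, z ^ k, …, 0)`. -/
def e (n : ℕ) (α : Fin n) (k : ℤ) : H n :=
  ContinuousMap.toLp 2 haarAddCircle ℂ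
    ⟨fun θ : UnitAddCircle => fourier k θ • EuclideanSpace.single α (1 : ℂ), by fun_prop⟩

/-- The closed subspace spanned by the `e_{α,k}` with `k ≥ 0`. -/
def Hplus (n : ℕ) : Submodule ℂ (H n) :=
  (Submodule.span ℂ {f | ∃ (α : Fin n) (k : ℤ), 0 ≤ k ∧ f = e n α k}).topologicalClosure

/-- The closed subspace spanned by the `e_{α,k}` with `k < 0`. -/
def Hminus (n : ℕ) : Submodule ℂ (H n) :=
  (Submodule.span ℂ {f | ∃ (α : Fin n) (k : ℤ), k < 0 ∧ f = e n α k}).topologicalClosure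

instance (n : ℕ) : CompleteSpace (Hplus n) :=
  inferInstanceAs (CompleteSpace (Submodule.topologicalClosure _))

instance (n : ℕ) : CompleteSpace (Hminus n) :=
  inferInstanceAs (CompleteSpace (Submodule.topologicalClosure _))

/-- The orthogonal projection `W → H₊`. -/
def prPlus {n : ℕ} (W : Submodule ℂ (H n)) : W →L[ℂ] Hplus n :=
  (Hplus n).orthogonalProjectionOnto ∘L W.subtypeL

/-- The orthogonal projection `W → H₋`. -/
def prMinus {n : ℕ} (W : Submodule ℂ (H n)) : W →L[ℂ] Hminus n :=
  (Hminus n).orthogonalProjectionOnto ∘L W.subtypeL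

/-- Hilbert–Schmidt operators: `∑ ‖T bᵢ‖² < ∞` for an orthonormal basis `b`. -/
def IsHilbertSchmidt {E F : Type*} [NormedAddCommGroup E] [InnerProductSpace ℂ E]
    [NormedAddCommGroup F] [InnerProductSpace ℂ F] (T : E →L[ℂ] F) : Prop :=
  ∃ (s : Set E) (b : HilbertBasis s ℂ E), Summable fun i => ‖T (b i)‖ ^ 2

/-- `Gr⁽ⁿ⁾`: closed subspaces `W` of `L²(S¹, ℂⁿ)` such that `pr₊ : W → H₊` is Fredholm,
`pr₋ : W → H₋` is Hilbert–Schmidt and `z W ⊆ W`. -/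
structure IsGr {n : ℕ} (W : Submodule ℂ (H n)) : Prop where
  isClosed : IsClosed (W : Set (H n))
  fredholm : (prPlus W).IsFredholm
  hilbertSchmidt : IsHilbertSchmidt (prMinus W)
  mul_z : ∀ f ∈ W, ∀ g : H n, (g =ᵐ[haarAddCircle] fun θ => fourier 1 θ • f θ) → g ∈ W

/-- The big cell: `pr₊ : W → H₊` is an isomorphism. -/
def InBigCell {n : ℕ} (W : Submodule ℂ (H n)) : Prop :=
  Function.Bijective (prPlus W)

/-- The columns `w₁, …, wₙ` of a normalized matrix `𝒲(z)` attached to `W`: they lie in `W`, and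
the matrix with these columns is a constant upper triangular matrix with ones on the diagonal
plus a series in strictly negative powers of `z`. -/
structure IsNormalizedFrame {n : ℕ} (W : Submodule ℂ (H n)) (w : Fin n → H n) : Prop where
  mem : ∀ j, w j ∈ W
  pos : ∀ j i, ∀ k : ℤ, 0 < k → fourierCoeff (w j : UnitAddCircle → _) k i = 0
  diag : ∀ j, fourierCoeff (w j : UnitAddCircle → _) 0 j = 1
  lower : ∀ j i, j < i → fourierCoeff (w j : UnitAddCircle → _) 0 i = 0

/-- `Ξ (f₀, …, f_{n-1}) (z) = f₀(zⁿ) + z f₁(zⁿ) + ⋯ + z ^ (n-1) f_{n-1}(zⁿ)`. -/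
def Xi {n : ℕ} (f : H n) (θ : UnitAddCircle) : ℂ :=
  ∑ i : Fin n, fourier (i : ℤ) θ * f (n • θ) i

/-- `omega w m` is `ω_{m+1}`, where `ω_{ns+j} = z ^ (ns) Ξ(w_j)` for `j = 1, …, n`. -/
def omega {n : ℕ} [NeZero n] (w : Fin n → H n) (m : ℕ) (θ : UnitAddCircle) : ℂ :=
  fourier ((n * (m / n) : ℕ) : ℤ) θ * Xi (w (Fin.ofNat n m)) θ

/-! ### Formal power series in the times -/

/-- Formal power series in the times `t₁, t₂, …`. -/
abbrev R : Type := MvPowerSeries ℕ+ ℂ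

/-- The degree of a monomial, `t_m` having degree `m`. -/
def wt (d : ℕ+ →₀ ℕ) : ℕ := d.sum fun i m => (i : ℕ) * m

/-- `∂/∂t_j`. -/
abbrev pd (j : ℕ+) (f : R) : R := MvPowerSeries.pderiv ℂ j f

/-- `D = ∂/∂t₁`. -/
abbrev D (f : R) : R := pd 1 f

/-- `F` is the limit of the sequence `f` of formal graded series: the degree of the lowest term
of `f N - F` tends to infinity. -/
def IsStableLimit (f : ℕ → R) (F : R) : Prop :=
  ∀ Q : ℕ, ∃ N₀ : ℕ, ∀ N ≥ N₀, ∀ d : ℕ+ →₀ ℕ, wt d ≤ Q →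
    MvPowerSeries.coeff d (f N) = MvPowerSeries.coeff d F

/-- The coefficient of `t ^ d` in `exp ξ(t,z)`, `ξ(t,z) = ∑ tᵢ zⁱ`: it is `z ^ (wt d) / ∏ dᵢ!`. -/
def expXiCoeff (d : ℕ+ →₀ ℕ) (θ : UnitAddCircle) : ℂ :=
  (d.prod fun _ m => ((m.factorial : ℂ))⁻¹) * fourier (wt d : ℤ) θ

/-- `(2πi)⁻¹ ∮ z ^ (-i) exp ξ(t,z) g(z) dz`, that is, the coefficient of `z ^ (i-1)` in
`exp ξ(t,z) g(z)`, as a formal series in `t`. -/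
def moment (i : ℕ) (g : UnitAddCircle → ℂ) : R :=
  fun d => fourierCoeff (fun θ => expXiCoeff d θ * g θ) ((i : ℤ) - 1)

/-- `τ_{W,N}(t) = det [∮ z ^ (-i) ω_j(t;z) dz]`, `1 ≤ i, j ≤ nN`. -/
def tauN {n : ℕ} [NeZero n] (w : Fin n → H n) (N : ℕ) : R :=
  (Matrix.of fun i j : Fin (n * N) => moment (i + 1) (omega w j)).det

/-- `Wr(f₁, …, f_M) = det [D ^ (M-j) fᵢ]`, `1 ≤ i, j ≤ M`. -/
def wronskian {M : ℕ} (f : Fin M → R) : R :=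
  (Matrix.of fun i j : Fin M => D^[M - 1 - j] (f i)).det

/-! ### Pseudo-differential operators -/

/-- Pseudo-differential operators `∑_{k ≤ K} a_k D ^ k` with coefficients in `R`. -/
@[ext]
structure PDO where
  coeff : ℤ → R
  bdd : ∃ K : ℤ, ∀ k > K, coeff k = 0

/-- The coefficients of `(∑ aᵢ Dⁱ)(∑ b_j D^j)`, where
`Dⁱ b = ∑_{l ≥ 0} (i choose l) D^l(b) D^(i-l)` for all integers `i`. -/
def leibniz (a b : ℤ → R) (m : ℤ) : R :=
  ∑ᶠ p : ℤ × ℕ, Ring.choose p.1 p.2 • (a p.1 * D^[p.2] (b (m - p.1 + p.2)))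

theorem leibniz_bdd {a b : ℤ → R} (ha : ∃ K : ℤ, ∀ k > K, a k = 0)
    (hb : ∃ K : ℤ, ∀ k > K, b k = 0) : ∃ K : ℤ, ∀ k > K, leibniz a b k = 0 := by
  obtain ⟨A, hA⟩ := ha
  obtain ⟨B, hB⟩ := hb
  have hD : ∀ l : ℕ, D^[l] (0 : R) = 0 := fun l =>
    Function.iterate_fixed (map_zero (MvPowerSeries.pderiv ℂ 1)) l
  refine ⟨A + B, fun k hk => ?_⟩
  unfold leibniz
  rw [← finsum_zero (α := ℤ × ℕ)]
  congr 1
  funext p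
  by_cases h : p.1 > A
  · simp [hA _ h]
  · rw [hB (k - p.1 + p.2) (by omega), hD]
    simp

namespace PDO

instance : Zero PDO := ⟨⟨fun _ => 0, 0, fun _ _ => rfl⟩⟩

/-- `D ^ k` for an integer `k`. -/
def Dpow (k : ℤ) : PDO := ⟨fun i => if i = k then 1 else 0, k, fun i hi => if_neg (by omega)⟩

instance : One PDO := ⟨Dpow 0⟩

instance : Sub PDO where
  sub a b := ⟨fun k => a.coeff k - b.coeff k, by
    obtain ⟨A, hA⟩ := a.bdd
    obtain ⟨B, hB⟩ := b.bdd
    exact ⟨max A B, fun k hk => by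
      rw [hA k (lt_of_le_of_lt (le_max_left _ _) hk),
        hB k (lt_of_le_of_lt (le_max_right _ _) hk), sub_zero]⟩⟩

/-- Composition. -/
instance : Mul PDO := ⟨fun a b => ⟨leibniz a.coeff b.coeff, leibniz_bdd a.bdd b.bdd⟩⟩

instance : Pow PDO ℕ := ⟨fun a k => npowRec k a⟩

open Classical in
/-- The two-sided inverse, if there is one. -/
instance : Inv PDO := ⟨fun a => if h : ∃ b : PDO, a * b = 1 ∧ b * a = 1 then h.choose else 0⟩

/-- The commutator. -/
def comm (a b : PDO) : PDO := a * b - b * a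

/-- The differential part `a₊`. -/
def plus (a : PDO) : PDO :=
  ⟨fun k => if 0 ≤ k then a.coeff k else 0, by
    obtain ⟨A, hA⟩ := a.bdd
    exact ⟨A, fun k hk => by rw [hA k hk, ite_self]⟩⟩

/-- `∂a/∂t_j`, coefficient by coefficient. -/
def tderiv (j : ℕ+) (a : PDO) : PDO :=
  ⟨fun k => pd j (a.coeff k), by
    obtain ⟨A, hA⟩ := a.bdd
    exact ⟨A, fun k hk => by rw [hA k hk]; exact map_zero _⟩⟩

/-- `a = D ^ m + (lower order terms)`. -/
def IsMonic (a : PDO) (m : ℤ) : Prop := a.coeff m = 1 ∧ ∀ k > m, a.coeff k = 0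

/-- Stable limit of every coefficient. -/
def IsStableLimit (a : ℕ → PDO) (A : PDO) : Prop :=
  ∀ k : ℤ, GelfandDickey.IsStableLimit (fun N => (a N).coeff k) (A.coeff k)

end PDO

/-! ### Formal wave functions -/

/-- Formal expressions `exp ξ(t,z) ∑_{k ≤ K} c_k(t) z ^ k`. -/
@[ext]
structure Wave where
  coeff : ℤ → R
  bdd : ∃ K : ℤ, ∀ k > K, coeff k = 0

namespace Wave

/-- `exp ξ(t,z)`. -/
def expXi : Wave := ⟨fun k => if k = 0 then 1 else 0, 0, fun _ hk => if_neg (by omega)⟩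

/-- The action of pseudo-differential operators, determined by
`Dⁱ (c exp ξ) = ∑_{l ≥ 0} (i choose l) D^l(c) z ^ (i-l) exp ξ`. -/
def act (a : PDO) (f : Wave) : Wave :=
  ⟨leibniz a.coeff f.coeff, leibniz_bdd a.bdd f.bdd⟩

/-- Multiplication by `z ^ m`. -/
def zmul (m : ℤ) (f : Wave) : Wave :=
  ⟨fun k => f.coeff (k - m), by
    obtain ⟨A, hA⟩ := f.bdd
    exact ⟨A + m, fun k hk => hA _ (by omega)⟩⟩

/-- `∂/∂t_j (exp ξ c z ^ k) = exp ξ (∂c/∂t_j z ^ k + c z ^ (k+j))`. -/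
def tderiv (j : ℕ+) (f : Wave) : Wave :=
  ⟨fun k => pd j (f.coeff k) + f.coeff (k - (j : ℕ)), by
    obtain ⟨A, hA⟩ := f.bdd
    refine ⟨A + (j : ℕ), fun k hk => ?_⟩
    rw [hA k (by have := j.pos; omega), hA (k - (j : ℕ)) (by omega), add_zero]
    exact map_zero _⟩

/-- Stable limit of every coefficient. -/
def IsStableLimit (f : ℕ → Wave) (F : Wave) : Prop :=
  ∀ k : ℤ, GelfandDickey.IsStableLimit (fun N => (f N).coeff k) (F.coeff k)

end Wave

/-- The coefficient of `z ^ (-m)` in `τ(t₁ - 1/z, t₂ - 1/(2z²), t₃ - 1/(3z³), …)`. -/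
def miwa (τ : R) (m : ℕ) : R :=
  fun d => ∑ᶠ (c : ℕ+ →₀ ℕ) (_ : wt c = m), MvPowerSeries.coeff (d + c) τ *
    c.prod fun i k => ((d i + k).choose k : ℂ) * (-1 / (i : ℂ)) ^ k

/-- `exp ξ(t,z) τ(t - [z⁻¹]) / τ(t)`. -/
def waveOfTau (τ : R) : Wave :=
  ⟨fun k => if k ≤ 0 then miwa τ (-k).toNat * τ⁻¹ else 0, 0, fun _ hk => if_neg (by omega)⟩

/-! ### The truncated objects attached to `W` -/

/-- `f_{s+1,N} = ∮ z ^ (-nN) ω_{s+1}(t;z) dz = ∑_k ω_{s+1}^{(-k)} p_{k+nN-1}(t)`, `p_m` being the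
Schur polynomials. -/
def fN {n : ℕ} [NeZero n] (w : Fin n → H n) (N : ℕ) (s : Fin (n * N)) : R :=
  moment (n * N) (omega w s)

/-- The differential operator `f ↦ Wr(f, f_{1,N}, …, f_{nN,N}) / Wr(f_{1,N}, …, f_{nN,N})`; the
coefficient of `D ^ k` is read off from the expansion of the numerator along its first row
`(D ^ (nN) f, …, D f, f)`. -/
def DeltaN {n : ℕ} [NeZero n] (w : Fin n → H n) (N : ℕ) : PDO :=
  ⟨fun k => (Matrix.of (Fin.cons (fun j : Fin (n * N + 1) => if k = (n * N : ℕ) - (j : ℤ) then 1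
      else 0) fun (i : Fin (n * N)) j => D^[n * N - j] (fN w N i))).det * (wronskian (fN w N))⁻¹, by
    refine ⟨(n * N : ℕ), fun k hk => ?_⟩
    rw [Matrix.det_eq_zero_of_row_eq_zero 0, zero_mul]
    intro j
    exact if_neg (by omega)⟩

/-- `S_{W,N} = Δ_{W,N} D ^ (-nN)`. -/
def SN {n : ℕ} [NeZero n] (w : Fin n → H n) (N : ℕ) : PDO :=
  DeltaN w N * PDO.Dpow (-(n * N : ℕ))

/-- `ψ_{W,N} = S_{W,N} exp ξ`. -/
def psiN {n : ℕ} [NeZero n] (w : Fin n → H n) (N : ℕ) : Wave :=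
  Wave.act (SN w N) Wave.expXi

/-- `𝓛_{W,N} = S_{W,N} D S_{W,N}⁻¹`. -/
def LaxN {n : ℕ} [NeZero n] (w : Fin n → H n) (N : ℕ) : PDO :=
  SN w N * PDO.Dpow 1 * (SN w N)⁻¹

/-! ### The hierarchies -/

/-- `𝓛 = D + O(D⁻¹)` solves the KP hierarchy `∂𝓛/∂t_j = [(𝓛 ^ j)₊, 𝓛]`. -/
structure IsKPSolution (𝓛 : PDO) : Prop where
  monic : 𝓛.IsMonic 1
  sub : 𝓛.coeff 0 = 0
  lax : ∀ j : ℕ+, 𝓛.tderiv j = PDO.comm (𝓛 ^ (j : ℕ)).plus 𝓛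

/-- `L = D ^ n + u_{n-2} D ^ (n-2) + ⋯ + u₀` is a differential operator of order `n` that, together
with its `n`-th root `𝓛`, solves the `n`-th Gelfand–Dickey hierarchy
`∂L/∂t_j = [(L ^ (j/n))₊, L]`. For `n ∣ j` the equation says that `L` does not depend on `t_j`. -/
structure IsGelfandDickeySolution (n : ℕ) (L 𝓛 : PDO) : Prop where
  monic : L.IsMonic n
  sub : L.coeff (n - 1) = 0
  differential : L = L.plus
  root_monic : 𝓛.IsMonic 1
  root : 𝓛 ^ n = L
  lax : ∀ j : ℕ+, L.tderiv j = PDO.comm (𝓛 ^ (j : ℕ)).plus L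
  stationary : ∀ j : ℕ+, n ∣ j → ∀ k, pd j (L.coeff k) = 0

/-- `ψ = exp ξ (1 + O(z⁻¹))` is a wave function of the solution `L`, with `n`-th root `𝓛`, of the
`n`-th Gelfand–Dickey hierarchy. -/
structure IsWaveFunction (n : ℕ) (L 𝓛 : PDO) (ψ : Wave) : Prop where
  leading : ψ.coeff 0 = 1
  pos : ∀ k > 0, ψ.coeff k = 0
  eigen : Wave.act L ψ = Wave.zmul n ψ
  evolution : ∀ j : ℕ+, ψ.tderiv j = Wave.act (𝓛 ^ (j : ℕ)).plus ψ

/-- `τ` is a `τ`-function for the wave function `ψ`. -/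
structure IsTauFunction (ψ : Wave) (τ : R) : Prop where
  ne_zero : MvPowerSeries.constantCoeff τ ≠ 0
  wave : ψ = waveOfTau τ

end

end GelfandDickey

open GelfandDickey

namespace GelfandDickey

open MeasureTheory AddCircle

noncomputable section

/-! ### The ring of pseudo-differential operators -/

/-! Everything rests on one fact: if `g_a` is the coefficient of `z ^ a` in `exp ξ · ω(z)`, then
`∂g_a/∂t_j = g_{a-j}`. Hence `∂f_s/∂t_j = D ^ j f_s` for the functions `f_{s,N}`, and their
Wronskian is `τ_{W,N}` itself (`wronskian_fN`). The shift `t ↦ t - [x]`, `x = z⁻¹`, sends `g_a` to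
`g_a - x g_{a-1}`. A column operation then turns `τ_{W,N}(t - [x])` into the first-row expansion of
the numerator of `Δ_{W,N}` (`miwaHom_tauDet`). So the `τ`-function formula is exact for every `N`,
the operator `S_{W,N}` is a function of `τ_{W,N}` (`coeff_SN`), and its convergence reduces to that
of `τ_{W,N}`.

The determinants converge because, modulo terms of degree greater than `M`, the last row of the one
of size `M + 1` can be made `(0, …, 0, 1)` after multiplication by `exp (-ξ)` (`tauDet_succ_sub`).

The equations come from division: an operator annihilating all `f_{s,N}` is a differential operator
times `Δ_{W,N}` (`PDO.exists_eq_mul_of_app_eq_zero`). Applied to `∂Δ/∂t_j + Δ D ^ j` this gives the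
Sato equation (`exists_tderiv_SN`). Applied to `Δ_{W,N+1}`, which annihilates the `f_{s,N}` because
`ω_{s+n} = z ^ n ω_s`, it makes `S_{W,N+1} D ^ n S_{W,N}⁻¹` differential (`exists_SN_succ`). Both
properties survive the limit, and the hierarchies follow by algebra with `S`.

The big cell enters through frames only: bijectivity of `pr₊` gives a frame whose matrix is `1` plus
negative powers, and every normalized frame differs from it by a constant unipotent matrix, which
does not change `τ_{W,N}`. -/

theorem D_add (f g : R) : D (f + g) = D f + D g := map_add _ _ _

theorem pd_mul (j : ℕ+) (f g : R) : pd j (f * g) = pd j f * g + f * pd j g := by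
  rw [pd, Derivation.leibniz, smul_eq_mul, smul_eq_mul]; ring

theorem pd_sum {ι : Type*} (j : ℕ+) (s : Finset ι) (f : ι → R) :
    pd j (∑ i ∈ s, f i) = ∑ i ∈ s, pd j (f i) := map_sum (MvPowerSeries.pderiv ℂ j) f s

theorem pd_zsmul (j : ℕ+) (k : ℤ) (f : R) : pd j (k • f) = k • pd j f :=
  map_zsmul (MvPowerSeries.pderiv ℂ j) k f

theorem D_iterate_zero (l : ℕ) : D^[l] (0 : R) = 0 :=
  Function.iterate_fixed (map_zero (MvPowerSeries.pderiv ℂ 1)) l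

theorem D_iterate_add (l : ℕ) (f g : R) : D^[l] (f + g) = D^[l] f + D^[l] g := by
  induction l with
  | zero => rfl
  | succ l ih => rw [Function.iterate_succ_apply', ih, D_add, Function.iterate_succ_apply',
      Function.iterate_succ_apply']

theorem D_iterate_one {l : ℕ} (hl : l ≠ 0) : D^[l] (1 : R) = 0 := by
  obtain ⟨l, rfl⟩ := Nat.exists_eq_succ_of_ne_zero hl
  rw [Function.iterate_succ_apply, show D (1 : R) = 0 from MvPowerSeries.pderiv_one,
    D_iterate_zero]

/-- `a_k = 0` for `k > K`. -/
def SeqLE (a : ℤ → R) (K : ℤ) : Prop := ∀ k > K, a k = 0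

/-- The coefficients of `Dⁱ ∘ (∑ b_k D ^ k)`. -/
def Dcomp (i : ℤ) (b : ℤ → R) (m : ℤ) : R :=
  ∑ᶠ l : ℕ, Ring.choose i l • D^[l] (b (m - i + l))

theorem Dcomp_eq_sum {b : ℤ → R} {B : ℤ} (hb : SeqLE b B) (i m : ℤ) {L : ℕ}
    (hL : B - m + i < L) :
    Dcomp i b m = ∑ l ∈ Finset.range L, Ring.choose i l • D^[l] (b (m - i + l)) := by
  refine finsum_eq_sum_of_support_subset _ fun l hl => ?_
  by_contra h
  simp only [Finset.coe_range, Set.mem_Iio, not_lt] at h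
  exact hl (by dsimp only; rw [hb _ (by omega), D_iterate_zero, smul_zero])

theorem Dcomp_le {b : ℤ → R} {B : ℤ} (hb : SeqLE b B) (i : ℤ) : SeqLE (Dcomp i b) (B + i) :=
  fun m hm => by rw [Dcomp_eq_sum hb i m (L := 0) (by simpa using by omega), Finset.sum_range_zero]

/-- Above `A` the left factor vanishes; below `m - B` only vanishing coefficients of `b` are
reached. The window is left free so that several products can be summed over one common range. -/
theorem leibniz_eq_sum {a b : ℤ → R} {A B : ℤ} (ha : SeqLE a A) (hb : SeqLE b B) (m : ℤ)
    {lo hi : ℤ} (hlo : lo ≤ m - B) (hhi : A ≤ hi) :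
    leibniz a b m = ∑ i ∈ Finset.Icc lo hi, a i * Dcomp i b m := by
  have : leibniz a b m = ∑ p ∈ Finset.Icc lo hi ×ˢ Finset.range (B - m + hi + 1).toNat,
      Ring.choose p.1 p.2 • (a p.1 * D^[p.2] (b (m - p.1 + p.2))) := by
    refine finsum_eq_sum_of_support_subset _ fun p hp => ?_
    by_contra h
    refine hp ?_
    dsimp only
    simp only [Finset.coe_product, Finset.coe_Icc, Finset.coe_range, Set.mem_prod, Set.mem_Icc,
      Set.mem_Iio] at h
    by_cases h1 : p.1 > A
    · rw [ha _ h1, zero_mul, smul_zero]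
    · rw [hb _ (by omega), D_iterate_zero, mul_zero, smul_zero]
  rw [this, Finset.sum_product]
  refine Finset.sum_congr rfl fun i hi' => ?_
  rw [Finset.mem_Icc] at hi'
  rw [Dcomp_eq_sum hb i m (L := (B - m + hi + 1).toNat) (by omega), Finset.mul_sum]
  exact Finset.sum_congr rfl fun l _ => (mul_smul_comm _ _ _).symm

theorem SeqLE.leibniz {a b : ℤ → R} {A B : ℤ} (ha : SeqLE a A) (hb : SeqLE b B) :
    SeqLE (leibniz a b) (A + B) := fun m hm => by
  rw [leibniz_eq_sum ha hb m le_rfl le_rfl, Finset.Icc_eq_empty (by omega), Finset.sum_empty]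

/-- The coefficients of `D ∘ (∑ f_k D ^ k)`. -/
def Dleft (f : ℤ → R) (m : ℤ) : R := D (f m) + f (m - 1)

theorem SeqLE.mono {a : ℤ → R} {A A' : ℤ} (ha : SeqLE a A) (h : A ≤ A') : SeqLE a A' :=
  fun k hk => ha k (by omega)

theorem SeqLE.add {a b : ℤ → R} {K : ℤ} (ha : SeqLE a K) (hb : SeqLE b K) : SeqLE (a + b) K :=
  fun k hk => by rw [Pi.add_apply, ha k hk, hb k hk, add_zero]

theorem SeqLE.neg {a : ℤ → R} {K : ℤ} (ha : SeqLE a K) : SeqLE (-a) K :=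
  fun k hk => by rw [Pi.neg_apply, ha k hk, neg_zero]

theorem SeqLE.shift {a : ℤ → R} {K : ℤ} (ha : SeqLE a K) : SeqLE (fun j => a (j - 1)) (K + 1) :=
  fun k hk => ha _ (by omega)

theorem SeqLE.deriv {a : ℤ → R} {K : ℤ} (ha : SeqLE a K) (j : ℕ+) :
    SeqLE (fun k => pd j (a k)) K :=
  fun k hk => by simp only [ha k hk]; exact map_zero _

/-- Coefficient `m + 1` of `D ∘ f` is `D (f (m + 1)) + f m`, so the coefficients are recovered from
the top downwards, starting where both vanish. This cancellation of `D` is what reaches negative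
powers in `Dcomp_leibniz`. -/
theorem Dleft_injective {f g : ℤ → R} {F G : ℤ} (hf : SeqLE f F) (hg : SeqLE g G)
    (h : Dleft f = Dleft g) : f = g := by
  have key : ∀ k : ℕ, ∀ m, max F G - k ≤ m → f m = g m := by
    intro k
    induction k with
    | zero => 
      intro m hm
      rcases eq_or_lt_of_le hm with h' | h'
      · have h1 := congrFun h (m + 1)
        simp only [Dleft, hf (m + 1) (by omega), hg (m + 1) (by omega), add_sub_cancel_right,
          map_zero, zero_add] at h1
        exact h1
      · rw [hf _ (by omega), hg _ (by omega)]
    | succ k ih =>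
      intro m hm
      have h1 := congrFun h (m + 1)
      simp only [Dleft, ih (m + 1) (by push_cast at hm; omega), add_sub_cancel_right] at h1
      exact add_left_cancel h1
  funext m
  exact key (max F G - m).toNat m (by omega)

/-- Pascal's rule, which `Ring.choose` satisfies for negative `i` as well. -/
theorem Dcomp_succ {b : ℤ → R} {B : ℤ} (hb : SeqLE b B) (i : ℤ) :
    Dcomp (i + 1) b = Dleft (Dcomp i b) := by
  funext m
  set L := (B - m + i + 1).toNat
  rw [Dleft, Dcomp_eq_sum hb (i + 1) m (L := L + 1) (by omega), Dcomp_eq_sum hb i m (L := L)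
    (by omega), Dcomp_eq_sum hb i (m - 1) (L := L + 1) (by omega), Finset.sum_range_succ',
    Finset.sum_range_succ' _ L, D, pd_sum, ← add_assoc, ← Finset.sum_add_distrib]
  congr 1
  · refine Finset.sum_congr rfl fun l _ => ?_
    rw [Ring.choose_succ_succ, add_smul, pd_zsmul, Function.iterate_succ_apply',
      show m - (i + 1) + ((l + 1 : ℕ) : ℤ) = m - i + l by push_cast; ring,
      show m - 1 - i + ((l + 1 : ℕ) : ℤ) = m - i + l by push_cast; ring,
      Function.iterate_succ_apply']
  · simp only [Ring.choose_zero_right]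
    congr 3
    ring

theorem Dcomp_zero {b : ℤ → R} {B : ℤ} (hb : SeqLE b B) : Dcomp 0 b = b := by
  funext m
  rw [Dcomp_eq_sum hb 0 m (L := (B - m).toNat + 1) (by omega), Finset.sum_range_succ',
    Finset.sum_eq_zero]
  · simp
  · intro l _
    rw [Ring.choose_zero_succ, zero_smul]

theorem Dcomp_add {b c : ℤ → R} {K : ℤ} (hb : SeqLE b K) (hc : SeqLE c K) (i : ℤ) :
    Dcomp i (b + c) = Dcomp i b + Dcomp i c := by
  funext m
  set L := (K - m + i + 1).toNat
  rw [Pi.add_apply, Dcomp_eq_sum hb i m (L := L) (by omega), Dcomp_eq_sum hc i m (L := L)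
    (by omega), Dcomp_eq_sum (hb.add hc) i m (L := L) (by omega), ← Finset.sum_add_distrib]
  refine Finset.sum_congr rfl fun l _ => ?_
  rw [Pi.add_apply, D_iterate_add, smul_add]

theorem leibniz_add {a b c : ℤ → R} {A K : ℤ} (ha : SeqLE a A) (hb : SeqLE b K)
    (hc : SeqLE c K) : leibniz a (b + c) = leibniz a b + leibniz a c := by
  funext m
  rw [Pi.add_apply, leibniz_eq_sum ha hb m le_rfl le_rfl, leibniz_eq_sum ha hc m le_rfl le_rfl,
    leibniz_eq_sum ha (hb.add hc) m le_rfl le_rfl, ← Finset.sum_add_distrib]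
  refine Finset.sum_congr rfl fun l _ => ?_
  rw [Dcomp_add hb hc, Pi.add_apply, mul_add]

theorem add_leibniz {a b c : ℤ → R} {A K : ℤ} (ha : SeqLE a A) (hb : SeqLE b A)
    (hc : SeqLE c K) : leibniz (a + b) c = leibniz a c + leibniz b c := by
  funext m
  rw [Pi.add_apply, leibniz_eq_sum ha hc m le_rfl le_rfl, leibniz_eq_sum hb hc m le_rfl le_rfl,
    leibniz_eq_sum (ha.add hb) hc m le_rfl le_rfl, ← Finset.sum_add_distrib]
  refine Finset.sum_congr rfl fun l _ => ?_
  rw [Pi.add_apply, add_mul]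

/-- Associativity with `D` as left factor; it amounts to the product rule for `D (b_j · (D ^ j ∘
c)_m)`, once the shifted sum is reindexed by `j + 1`. -/
theorem Dleft_leibniz {b c : ℤ → R} {B C : ℤ} (hb : SeqLE b B) (hc : SeqLE c C) :
    Dleft (leibniz b c) = leibniz (Dleft b) c := by
  have h1 : Dleft b = (fun k => D (b k)) + fun k => b (k - 1) := rfl
  rw [h1, add_leibniz ((hb.deriv 1).mono (by omega : B ≤ B + 1)) hb.shift hc]
  funext m
  rw [Pi.add_apply, Dleft, leibniz_eq_sum hb hc m (lo := m - 1 - C) (by omega) le_rfl,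
    leibniz_eq_sum hb hc (m - 1) le_rfl le_rfl, leibniz_eq_sum (hb.deriv 1) hc m
      (lo := m - 1 - C) (by omega) le_rfl, leibniz_eq_sum hb.shift hc m le_rfl le_rfl, D, pd_sum,
    show m - C = (m - 1 - C) + 1 by ring, ← Finset.map_add_right_Icc, Finset.sum_map,
    ← Finset.sum_add_distrib, ← Finset.sum_add_distrib]
  refine Finset.sum_congr rfl fun j _ => ?_
  simp only [addRightEmbedding_apply, add_sub_cancel_right]
  rw [Dcomp_succ hc, Dleft, mul_add, pd_mul, add_assoc]

/-- The identities for `i` and `i + 1` are equivalent: compose with `D` to go up, cancel `D` to go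
down. Hence induction on the integer `i` from `0`. -/
theorem Dcomp_leibniz {b c : ℤ → R} {B C : ℤ} (hb : SeqLE b B) (hc : SeqLE c C) (i : ℤ) :
    Dcomp i (leibniz b c) = leibniz (Dcomp i b) c := by
  have hbc := hb.leibniz hc
  have step : ∀ i, (Dcomp (i + 1) (leibniz b c) = leibniz (Dcomp (i + 1) b) c) ↔
      Dcomp i (leibniz b c) = leibniz (Dcomp i b) c := by
    intro i
    rw [Dcomp_succ hbc, Dcomp_succ hb, ← Dleft_leibniz (Dcomp_le hb i) hc]
    exact ⟨fun h => Dleft_injective (Dcomp_le hbc i) ((Dcomp_le hb i).leibniz hc) h,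
      fun h => by rw [h]⟩
  induction i with
  | zero => rw [Dcomp_zero hbc, Dcomp_zero hb]
  | succ i ih => exact (step _).2 ih
  | pred i ih => exact (step _).1 (by rwa [sub_add_cancel])

theorem leibniz_assoc {a b c : ℤ → R} {A B C : ℤ} (ha : SeqLE a A) (hb : SeqLE b B)
    (hc : SeqLE c C) : leibniz (leibniz a b) c = leibniz a (leibniz b c) := by
  funext m
  rw [leibniz_eq_sum (ha.leibniz hb) hc m le_rfl le_rfl,
    leibniz_eq_sum ha (hb.leibniz hc) m le_rfl le_rfl]
  have h1 : ∀ q ∈ Finset.Icc (m - C) (A + B), leibniz a b q * Dcomp q c m =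
      ∑ i ∈ Finset.Icc (m - (B + C)) A, a i * (Dcomp i b q * Dcomp q c m) := by
    intro q hq
    rw [Finset.mem_Icc] at hq
    rw [leibniz_eq_sum ha hb q (lo := m - (B + C)) (by omega) le_rfl, Finset.sum_mul]
    exact Finset.sum_congr rfl fun i _ => mul_assoc _ _ _
  rw [Finset.sum_congr rfl h1, Finset.sum_comm]
  refine Finset.sum_congr rfl fun i hi => ?_
  rw [Finset.mem_Icc] at hi
  rw [← Finset.mul_sum, Dcomp_leibniz hb hc, leibniz_eq_sum (Dcomp_le hb i) hc m le_rfl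
    (hi := A + B) (by omega)]

namespace PDO

theorem exists_seqLE (a : PDO) : ∃ K, SeqLE a.coeff K := a.bdd

theorem exists_common_seqLE (a b : PDO) : ∃ K, SeqLE a.coeff K ∧ SeqLE b.coeff K := by
  obtain ⟨A, hA⟩ := a.exists_seqLE
  obtain ⟨B, hB⟩ := b.exists_seqLE
  exact ⟨max A B, hA.mono (le_max_left _ _), hB.mono (le_max_right _ _)⟩

instance : Add PDO where
  add a b := ⟨a.coeff + b.coeff, by
    obtain ⟨K, ha, hb⟩ := exists_common_seqLE a b
    exact ⟨K, ha.add hb⟩⟩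

instance : Neg PDO where
  neg a := ⟨-a.coeff, by
    obtain ⟨K, ha⟩ := a.exists_seqLE
    exact ⟨K, ha.neg⟩⟩

theorem coeff_add (a b : PDO) (k : ℤ) : (a + b).coeff k = a.coeff k + b.coeff k := rfl
theorem coeff_sub (a b : PDO) (k : ℤ) : (a - b).coeff k = a.coeff k - b.coeff k := rfl
theorem coeff_neg (a : PDO) (k : ℤ) : (-a).coeff k = -a.coeff k := rfl
theorem coeff_zero (k : ℤ) : (0 : PDO).coeff k = 0 := rfl
theorem coeff_one (k : ℤ) : (1 : PDO).coeff k = if k = 0 then 1 else 0 := rfl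
theorem coeff_mul (a b : PDO) : (a * b).coeff = leibniz a.coeff b.coeff := rfl
theorem coeff_Dpow (i k : ℤ) : (Dpow i).coeff k = if k = i then 1 else 0 := rfl

theorem Dpow_le (i : ℤ) : SeqLE (Dpow i).coeff i := fun k hk => if_neg (by omega)

theorem coeff_Dpow_mul (i : ℤ) (b : PDO) : (Dpow i * b).coeff = Dcomp i b.coeff := by
  obtain ⟨K, hb⟩ := b.exists_seqLE
  funext m
  rw [coeff_mul, leibniz_eq_sum (Dpow_le i) hb m (lo := min (m - K) i) (min_le_left _ _) le_rfl,
    Finset.sum_eq_single_of_mem i (by simp)]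
  · rw [coeff_Dpow, if_pos rfl, one_mul]
  · intro j _ hj
    rw [coeff_Dpow, if_neg hj, zero_mul]

theorem Dcomp_Dpow (i j m : ℤ) :
    Dcomp i (Dpow j).coeff m = if m = i + j then 1 else 0 := by
  rw [Dcomp, finsum_eq_single _ 0]
  · rw [Ring.choose_zero_right, one_smul, Function.iterate_zero_apply, coeff_Dpow]
    congr 1
    exact propext ⟨by push_cast; omega, by push_cast; omega⟩
  · intro l hl
    rw [coeff_Dpow]
    split
    · rw [D_iterate_one hl, smul_zero]
    · rw [D_iterate_zero, smul_zero]

theorem coeff_mul_Dpow (a : PDO) (j m : ℤ) : (a * Dpow j).coeff m = a.coeff (m - j) := by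
  obtain ⟨K, ha⟩ := a.exists_seqLE
  rw [coeff_mul, leibniz_eq_sum ha (Dpow_le j) m le_rfl (le_max_left K (m - j)),
    Finset.sum_eq_single_of_mem (m - j) (by simp)]
  · rw [Dcomp_Dpow, if_pos (by ring), mul_one]
  · intro i _ hi
    rw [Dcomp_Dpow, if_neg (by omega), mul_zero]

/-- The default `npow` is `npowRec`, the same recursion as in `Pow PDO ℕ`, so the monoid lemmas
apply to the powers in the hierarchies. -/
instance : Ring PDO where
  add_assoc a b c := PDO.ext (add_assoc a.coeff b.coeff c.coeff)
  zero_add a := PDO.ext (zero_add a.coeff)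
  add_zero a := PDO.ext (add_zero a.coeff)
  add_comm a b := PDO.ext (add_comm a.coeff b.coeff)
  neg_add_cancel a := PDO.ext (neg_add_cancel a.coeff)
  sub_eq_add_neg a b := PDO.ext (sub_eq_add_neg a.coeff b.coeff)
  nsmul := nsmulRec
  zsmul := zsmulRec
  mul_assoc a b c := PDO.ext <| by
    obtain ⟨A, ha⟩ := a.exists_seqLE
    obtain ⟨B, hb⟩ := b.exists_seqLE
    obtain ⟨C, hc⟩ := c.exists_seqLE
    exact leibniz_assoc ha hb hc
  one_mul a := PDO.ext <| by
    obtain ⟨A, ha⟩ := a.exists_seqLE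
    exact (coeff_Dpow_mul 0 a).trans (Dcomp_zero ha)
  mul_one a := PDO.ext <| funext fun m => (coeff_mul_Dpow a 0 m).trans (by rw [sub_zero])
  zero_mul a := PDO.ext <| by
    obtain ⟨A, ha⟩ := a.exists_seqLE
    funext m
    rw [coeff_mul, leibniz_eq_sum (a := coeff 0) (A := 0) (fun _ _ => rfl) ha m le_rfl le_rfl]
    exact Finset.sum_eq_zero fun i _ => zero_mul _
  mul_zero a := PDO.ext <| by
    obtain ⟨A, ha⟩ := a.exists_seqLE
    funext m
    rw [coeff_mul, leibniz_eq_sum (b := coeff 0) (B := m - A - 1) ha (fun _ _ => rfl) m le_rfl le_rfl,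
      Finset.Icc_eq_empty (by omega)]
    rfl
  left_distrib a b c := PDO.ext <| by
    obtain ⟨A, ha⟩ := a.exists_seqLE
    obtain ⟨K, hb, hc⟩ := exists_common_seqLE b c
    exact leibniz_add ha hb hc
  right_distrib a b c := PDO.ext <| by
    obtain ⟨A, hc⟩ := c.exists_seqLE
    obtain ⟨K, ha, hb⟩ := exists_common_seqLE a b
    exact add_leibniz ha hb hc

end PDO

/-! ### Time derivatives and top coefficients of compositions. -/

theorem pd_comm (i j : ℕ+) (f : R) : pd i (pd j f) = pd j (pd i f) := by
  ext d
  simp only [MvPowerSeries.coeff_pderiv]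
  rw [add_right_comm]
  by_cases h : i = j
  · rw [h]
  · simp [h, Ne.symm h]
    ring

theorem pd_D_iterate (j : ℕ+) (l : ℕ) (f : R) : pd j (D^[l] f) = D^[l] (pd j f) := by
  induction l with
  | zero => rfl
  | succ l ih => rw [Function.iterate_succ_apply', Function.iterate_succ_apply', pd_comm, ih]

theorem pd_Dcomp (j : ℕ+) {b : ℤ → R} {B : ℤ} (hb : SeqLE b B) (i m : ℤ) :
    pd j (Dcomp i b m) = Dcomp i (fun k => pd j (b k)) m := by
  set L := (B - m + i + 1).toNat
  rw [Dcomp_eq_sum hb i m (L := L) (by omega), Dcomp_eq_sum (hb.deriv j) i m (L := L) (by omega),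
    pd_sum]
  exact Finset.sum_congr rfl fun l _ => by rw [pd_zsmul, pd_D_iterate]

theorem Dcomp_top {b : ℤ → R} {B : ℤ} (hb : SeqLE b B) (i : ℤ) : Dcomp i b (B + i) = b B := by
  rw [Dcomp_eq_sum hb i _ (L := 1) (by push_cast; omega)]
  simp

theorem Dcomp_subtop {b : ℤ → R} {B : ℤ} (hb : SeqLE b B) (i : ℤ) :
    Dcomp i b (B + i - 1) = b (B - 1) + i • D (b B) := by
  rw [Dcomp_eq_sum hb i _ (L := 2) (by push_cast; omega), Finset.sum_range_succ,
    Finset.sum_range_one]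
  simp only [Ring.choose_zero_right, Ring.choose_one_right, one_smul, Function.iterate_zero_apply,
    Function.iterate_one]
  rw [show B + i - 1 - i + ((0 : ℕ) : ℤ) = B - 1 by push_cast; ring,
    show B + i - 1 - i + ((1 : ℕ) : ℤ) = B by push_cast; ring]

/-! ### Orders, leading terms and inverses of operators. -/

namespace PDO

/-- Taking the coefficient of `D ^ k`. -/
def coeffHom (k : ℤ) : PDO →+ R where
  toFun a := a.coeff k
  map_zero' := rfl
  map_add' _ _ := rfl

theorem coeff_sum {ι : Type*} (s : Finset ι) (a : ι → PDO) (k : ℤ) :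
    (∑ i ∈ s, a i).coeff k = ∑ i ∈ s, (a i).coeff k := map_sum (coeffHom k) a s

theorem mul_le {a b : PDO} {A B : ℤ} (ha : SeqLE a.coeff A) (hb : SeqLE b.coeff B) :
    SeqLE (a * b).coeff (A + B) := ha.leibniz hb

theorem sub_le {a b : PDO} {K : ℤ} (ha : SeqLE a.coeff K) (hb : SeqLE b.coeff K) :
    SeqLE (a - b).coeff K := fun k hk => by rw [coeff_sub, ha k hk, hb k hk, sub_zero]

theorem coeff_mul_top {a b : PDO} {A B : ℤ} (ha : SeqLE a.coeff A) (hb : SeqLE b.coeff B) :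
    (a * b).coeff (A + B) = a.coeff A * b.coeff B := by
  rw [coeff_mul, leibniz_eq_sum ha hb _ (lo := A) (by omega) le_rfl, Finset.Icc_self,
    Finset.sum_singleton, add_comm A B, Dcomp_top hb]

theorem coeff_mul_subtop {a b : PDO} {A B : ℤ} (ha : SeqLE a.coeff A) (hb : SeqLE b.coeff B) :
    (a * b).coeff (A + B - 1) =
      a.coeff (A - 1) * b.coeff B + a.coeff A * (b.coeff (B - 1) + A • D (b.coeff B)) := by
  have h : Finset.Icc (A - 1) A = {A - 1, A} := by
    ext x
    simp only [Finset.mem_Icc, Finset.mem_insert, Finset.mem_singleton]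
    omega
  rw [coeff_mul, leibniz_eq_sum ha hb _ (lo := A - 1) (by omega) le_rfl, h,
    Finset.sum_pair (by omega), ← Dcomp_subtop hb A, ← Dcomp_top hb (A - 1)]
  ring_nf

theorem IsMonic.mul {a b : PDO} {A B : ℤ} (ha : a.IsMonic A) (hb : b.IsMonic B) :
    (a * b).IsMonic (A + B) :=
  ⟨by rw [coeff_mul_top ha.2 hb.2, ha.1, hb.1, one_mul], mul_le ha.2 hb.2⟩

theorem isMonic_Dpow (k : ℤ) : (Dpow k).IsMonic k := ⟨if_pos rfl, Dpow_le k⟩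

theorem isMonic_one : (1 : PDO).IsMonic 0 := isMonic_Dpow 0

theorem IsMonic.pow {a : PDO} {A : ℤ} (ha : a.IsMonic A) (k : ℕ) : (a ^ k).IsMonic (k * A) := by
  induction k with
  | zero => simpa using isMonic_one
  | succ k ih => rw [pow_succ, Nat.cast_succ, add_mul, one_mul]; exact ih.mul ha

theorem Dpow_mul_Dpow (i j : ℤ) : Dpow i * Dpow j = Dpow (i + j) := by
  ext1
  funext m
  rw [coeff_mul_Dpow, coeff_Dpow, coeff_Dpow]
  congr 1
  exact propext ⟨fun h => by omega, fun h => by omega⟩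

theorem Dpow_zero : Dpow 0 = 1 := rfl

theorem pow_le {a : PDO} (ha : SeqLE a.coeff (-1)) (k : ℕ) : SeqLE (a ^ k).coeff (-k) := by
  induction k with
  | zero => exact isMonic_one.2
  | succ k ih => rw [pow_succ]; exact (mul_le ih ha).mono (by push_cast; omega)

/-- Geometric series in `c = 1 - a`: since `c ^ k` has order at most `-k`, only the powers `k ≤ -m`
contribute to the coefficient of `D ^ m`. -/
theorem IsMonic.exists_right_inv {a : PDO} (ha : a.IsMonic 0) :
    ∃ b : PDO, b.IsMonic 0 ∧ a * b = 1 := by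
  set c : PDO := 1 - a
  have hc : SeqLE c.coeff (-1) := by
    intro k hk
    rcases eq_or_lt_of_le (show 0 ≤ k by omega) with rfl | h
    · rw [coeff_sub, ha.1, isMonic_one.1, sub_self]
    · rw [coeff_sub, ha.2 k h, isMonic_one.2 k h, sub_self]
  let X : PDO := ⟨fun m => ∑ k ∈ Finset.range ((-m).toNat + 1), (c ^ k).coeff m, 0, fun m hm => by
    rw [Int.toNat_eq_zero.2 (by omega), Finset.sum_range_one, pow_zero, isMonic_one.2 m hm]⟩
  refine ⟨X, ⟨?_, ?_⟩, ?_⟩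
  · change ∑ k ∈ Finset.range ((-0 : ℤ).toNat + 1), (c ^ k).coeff 0 = 1
    simp [coeff_one]
  · intro m hm
    change ∑ k ∈ Finset.range ((-m).toNat + 1), (c ^ k).coeff m = 0
    rw [Int.toNat_eq_zero.2 (by omega), Finset.sum_range_one, pow_zero, isMonic_one.2 m hm]
  · ext1
    funext m
    set K := (-m).toNat
    -- The partial sum agrees with `X` in all orders at least `m`, and the telescoping remainder `c
    -- ^ (K + 1)` has order below `m`.
    set Y : PDO := ∑ k ∈ Finset.range (K + 1), c ^ k
    have hXY : SeqLE (X - Y).coeff (m - 1) := by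
      intro j hj
      rw [coeff_sub, coeff_sum, sub_eq_zero]
      change ∑ k ∈ Finset.range ((-j).toNat + 1), (c ^ k).coeff j = _
      refine Finset.sum_subset (Finset.range_mono (by omega)) fun k _ hk => ?_
      rw [Finset.mem_range] at hk
      exact pow_le hc k j (by omega)
    have h1 : a * X = 1 - c ^ (K + 1) + a * (X - Y) := by
      rw [← mul_neg_geom_sum, mul_sub, show (1 : PDO) - c = a by simp [c]]
      abel
    rw [h1, coeff_add, coeff_sub, mul_le ha.2 hXY m (by omega), pow_le hc (K + 1) m
      (by push_cast; omega), sub_zero, add_zero]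

theorem inv_eq_of_mul_eq_one {a b : PDO} (h1 : a * b = 1) (h2 : b * a = 1) : a⁻¹ = b := by
  have h : ∃ b : PDO, a * b = 1 ∧ b * a = 1 := ⟨b, h1, h2⟩
  have h3 : a⁻¹ = h.choose := dif_pos h
  rw [h3]
  exact left_inv_eq_right_inv h.choose_spec.2 h1

/-- The right inverse is again monic of order `0` and so has a right inverse of its own, which must
be `a`; thus the inverse is two-sided. -/
theorem IsMonic.inv_spec {a : PDO} (ha : a.IsMonic 0) :
    a⁻¹.IsMonic 0 ∧ a * a⁻¹ = 1 ∧ a⁻¹ * a = 1 := by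
  obtain ⟨b, hb, hab⟩ := ha.exists_right_inv
  obtain ⟨c, hc, hbc⟩ := hb.exists_right_inv
  have hba : b * a = 1 := by rwa [← left_inv_eq_right_inv hab hbc] at hbc
  rw [inv_eq_of_mul_eq_one hab hba]
  exact ⟨hb, hab, hba⟩

theorem IsMonic.mul_inv {a : PDO} (ha : a.IsMonic 0) : a * a⁻¹ = 1 := ha.inv_spec.2.1
theorem IsMonic.inv_mul {a : PDO} (ha : a.IsMonic 0) : a⁻¹ * a = 1 := ha.inv_spec.2.2
theorem IsMonic.inv {a : PDO} (ha : a.IsMonic 0) : a⁻¹.IsMonic 0 := ha.inv_spec.1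

/-! ### Time derivatives -/

theorem coeff_tderiv (j : ℕ+) (a : PDO) (k : ℤ) : (a.tderiv j).coeff k = pd j (a.coeff k) := rfl

theorem tderiv_mul (j : ℕ+) (a b : PDO) :
    (a * b).tderiv j = a.tderiv j * b + a * b.tderiv j := by
  obtain ⟨A, ha⟩ := a.exists_seqLE
  obtain ⟨B, hb⟩ := b.exists_seqLE
  ext1
  funext m
  rw [coeff_tderiv, coeff_add, coeff_mul, coeff_mul, coeff_mul,
    leibniz_eq_sum ha hb m le_rfl le_rfl,
    leibniz_eq_sum (a := (a.tderiv j).coeff) (ha.deriv j) hb m le_rfl le_rfl,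
    leibniz_eq_sum (b := (b.tderiv j).coeff) ha (hb.deriv j) m le_rfl le_rfl, pd_sum,
    ← Finset.sum_add_distrib]
  refine Finset.sum_congr rfl fun i _ => ?_
  rw [pd_mul, pd_Dcomp j hb]
  rfl

theorem tderiv_Dpow (j : ℕ+) (k : ℤ) : (Dpow k).tderiv j = 0 := by
  ext1
  funext m
  rw [coeff_tderiv, coeff_Dpow, coeff_zero]
  split
  · exact MvPowerSeries.pderiv_one
  · exact map_zero _

theorem tderiv_one (j : ℕ+) : (1 : PDO).tderiv j = 0 := tderiv_Dpow j 0

theorem tderiv_pow_eq_comm {j : ℕ+} {a b : PDO} (h : a.tderiv j = comm b a) (k : ℕ) :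
    (a ^ k).tderiv j = comm b (a ^ k) := by
  induction k with
  | zero => rw [pow_zero, tderiv_one, comm, mul_one, one_mul, sub_self]
  | succ k ih =>
    rw [pow_succ, tderiv_mul, ih, h]
    simp only [comm]
    noncomm_ring

theorem IsMonic.tderiv_le {a : PDO} {k : ℤ} (ha : a.IsMonic k) (j : ℕ+) :
    SeqLE (a.tderiv j).coeff (k - 1) := by
  intro m hm
  rw [coeff_tderiv]
  rcases eq_or_lt_of_le (show k ≤ m by omega) with rfl | h
  · rw [ha.1]; exact MvPowerSeries.pderiv_one
  · rw [ha.2 m h]; exact map_zero _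

/-! ### Differential operators -/

/-- Differential operators: no negative powers of `D`. -/
def IsDiff (a : PDO) : Prop := ∀ k < 0, a.coeff k = 0

theorem isDiff_plus (a : PDO) : a.plus.IsDiff := fun _ hk => if_neg (by omega)

theorem IsDiff.plus_eq {a : PDO} (ha : a.IsDiff) : a.plus = a := by
  ext1
  funext k
  change (if 0 ≤ k then a.coeff k else 0) = a.coeff k
  split
  · rfl
  · rw [ha k (by omega)]

theorem plus_eq_of_sub_le {a b : PDO} (hb : b.IsDiff) (h : SeqLE (a - b).coeff (-1)) :
    a.plus = b := by
  ext1
  funext k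
  change (if 0 ≤ k then a.coeff k else 0) = b.coeff k
  split
  · exact sub_eq_zero.1 (h k (by omega))
  · rw [hb k (by omega)]

theorem IsDiff.sub {a b : PDO} (ha : a.IsDiff) (hb : b.IsDiff) : (a - b).IsDiff :=
  fun k hk => by rw [coeff_sub, ha k hk, hb k hk, sub_zero]

theorem IsDiff.add {a b : PDO} (ha : a.IsDiff) (hb : b.IsDiff) : (a + b).IsDiff :=
  fun k hk => by rw [coeff_add, ha k hk, hb k hk, add_zero]

theorem IsDiff.tderiv {a : PDO} (ha : a.IsDiff) (j : ℕ+) : (a.tderiv j).IsDiff :=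
  fun k hk => by rw [coeff_tderiv, ha k hk]; exact map_zero _

theorem isDiff_Dpow (k : ℕ) : (Dpow k).IsDiff := fun m hm => if_neg (by omega)

theorem IsDiff.mul {a b : PDO} (ha : a.IsDiff) (hb : b.IsDiff) : (a * b).IsDiff := by
  intro m hm
  obtain ⟨A, hA⟩ := a.exists_seqLE
  obtain ⟨B, hB⟩ := b.exists_seqLE
  rw [coeff_mul, leibniz_eq_sum hA hB m le_rfl le_rfl]
  refine Finset.sum_eq_zero fun i _ => ?_
  rcases lt_or_ge i 0 with hi | hi
  · rw [ha i hi, zero_mul]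
  · lift i to ℕ using hi
    rw [Dcomp, finsum_eq_zero_of_forall_eq_zero, mul_zero]
    intro l
    rcases lt_or_ge i l with hl | hl
    · rw [Ring.choose_natCast, Nat.choose_eq_zero_of_lt hl, Nat.cast_zero, zero_smul]
    · rw [hb _ (by omega), D_iterate_zero, smul_zero]

theorem IsDiff.pow {a : PDO} (ha : a.IsDiff) (k : ℕ) : (a ^ k).IsDiff := by
  induction k with
  | zero => exact isDiff_Dpow 0
  | succ k ih => rw [pow_succ]; exact ih.mul ha

/-- The operator of multiplication by `f`. -/
def const (f : R) : PDO := ⟨fun k => if k = 0 then f else 0, 0, fun _ hk => if_neg (by omega)⟩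

theorem coeff_const (f : R) (k : ℤ) : (const f).coeff k = if k = 0 then f else 0 := rfl

theorem const_le (f : R) : SeqLE (const f).coeff 0 := fun _ hk => if_neg (by omega)

theorem isDiff_const (f : R) : (const f).IsDiff := fun _ hk => if_neg (by omega)

theorem tderiv_const (j : ℕ+) (f : R) : (const f).tderiv j = const (pd j f) := by
  ext1
  funext k
  rw [coeff_tderiv, coeff_const, coeff_const]
  split
  · rfl
  · exact map_zero _

/-- The action of differential operators on functions. -/
def app (a : PDO) (f : R) : R := (a * const f).coeff 0

/-- The operator `b ∘ f` minus multiplication by `b(f)` has no term of order `0`, hence equals `X D`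
with `X` differential; then `a X D` has no term of order `0` either. -/
theorem app_mul {a b : PDO} (ha : a.IsDiff) (hb : b.IsDiff) (f : R) :
    app (a * b) f = app a (app b f) := by
  set X := (b * const f - const (app b f)) * Dpow (-1)
  have hX : X.IsDiff := by
    intro k hk
    rw [coeff_mul_Dpow, coeff_sub]
    rcases eq_or_lt_of_le (show k - -1 ≤ 0 by omega) with h | h
    · rw [h, coeff_const, if_pos rfl]; exact sub_self _
    · rw [hb.mul (isDiff_const f) _ h, isDiff_const _ _ h, sub_zero]
  have h1 : a * b * const f = a * const (app b f) + a * X * Dpow 1 := by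
    simp only [X]
    rw [mul_assoc, mul_assoc, mul_assoc, Dpow_mul_Dpow, neg_add_cancel, Dpow_zero, mul_one,
      mul_sub]
    abel
  rw [app, h1, coeff_add, coeff_mul_Dpow, ha.mul hX _ (by norm_num), add_zero]
  rfl

theorem app_add (a b : PDO) (f : R) : app (a + b) f = app a f + app b f := by
  rw [app, add_mul, coeff_add]; rfl

theorem app_sub (a b : PDO) (f : R) : app (a - b) f = app a f - app b f := by
  rw [app, sub_mul, coeff_sub]; rfl

theorem pd_app (j : ℕ+) (a : PDO) (f : R) :
    pd j (app a f) = app (a.tderiv j) f + app a (pd j f) := by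
  rw [app, ← coeff_tderiv, tderiv_mul, tderiv_const, coeff_add]; rfl

theorem app_zero (a : PDO) : app a 0 = 0 := by
  have : const 0 = 0 := by
    ext1
    funext k
    rw [coeff_const, ite_self]; rfl
  rw [app, this, mul_zero]; rfl

theorem app_eq_sum {a : PDO} {M : ℕ} (hM : SeqLE a.coeff (M - 1)) (f : R) :
    app a f = ∑ k ∈ Finset.range M, a.coeff k * D^[k] f := by
  rw [app, coeff_mul, leibniz_eq_sum hM (const_le f) 0 (lo := 0) (by simp) le_rfl]
  symm
  refine Finset.sum_of_injOn (fun k : ℕ => (k : ℤ)) Nat.cast_injective.injOn ?_ ?_ ?_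
  · intro k hk
    simp only [Finset.coe_range, Set.mem_Iio, Finset.coe_Icc, Set.mem_Icc] at hk ⊢
    omega
  · intro i hi hi'
    rw [Finset.mem_Icc] at hi
    exact absurd ⟨i.toNat, by simp; omega, by simp; omega⟩ hi'
  · intro k _
    rw [Dcomp, finsum_eq_single _ k]
    · rw [Ring.choose_natCast, Nat.choose_self, Nat.cast_one, one_smul, coeff_const,
        if_pos (by ring)]
    · intro l hl
      rw [coeff_const, if_neg (by omega), D_iterate_zero, smul_zero]

theorem app_Dpow (k : ℕ) (f : R) : app (Dpow k) f = D^[k] f := by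
  rw [app_eq_sum (M := k + 1) ((Dpow_le k).mono (by push_cast; omega)),
    Finset.sum_eq_single_of_mem k (by simp)]
  · rw [coeff_Dpow, if_pos rfl, one_mul]
  · intro l _ hl
    rw [coeff_Dpow, if_neg (by exact_mod_cast hl), zero_mul]

/-- A differential operator that annihilates a fundamental system of solutions of `Δ` is
divisible by `Δ` on the right. -/
theorem exists_eq_mul_of_app_eq_zero {Δ P : PDO} {M : ℕ} (hΔ : Δ.IsDiff) (hm : Δ.IsMonic M)
    {f : Fin M → R} (hf : wronskian f ≠ 0) (hΔf : ∀ s, app Δ (f s) = 0) (hP : P.IsDiff)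
    (hPf : ∀ s, app P (f s) = 0) : ∃ B : PDO, B.IsDiff ∧ P = B * Δ := by
  have hS : (Δ * Dpow (-M)).IsMonic 0 := by
    have := hm.mul (isMonic_Dpow (-M))
    rwa [add_neg_cancel] at this
  set S := Δ * Dpow (-M)
  -- The quotient `P Δ⁻¹` taken among pseudo-differential operators; its differential part will be
  -- the wanted factor.
  set Q := P * (Dpow (-M) * S⁻¹)
  have hQ : Q * Δ = P := by
    have h1 : Δ = S * Dpow M := by
      simp only [S]
      rw [mul_assoc, Dpow_mul_Dpow, neg_add_cancel, Dpow_zero, mul_one]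
    rw [h1, mul_assoc, mul_assoc, ← mul_assoc S⁻¹, hS.inv_mul, one_mul, Dpow_mul_Dpow,
      neg_add_cancel, Dpow_zero, mul_one]
  refine ⟨Q.plus, isDiff_plus Q, ?_⟩
  -- The remainder equals `(Q - Q₊) Δ`, so it has order below `M`, and it still annihilates every `f
  -- s`.
  set T := P - Q.plus * Δ with hT
  have hTd : T.IsDiff := hP.sub ((isDiff_plus Q).mul hΔ)
  have hTle : SeqLE T.coeff (M - 1) := by
    have h1 : SeqLE (Q - Q.plus).coeff (-1) := by
      intro k hk
      rw [coeff_sub, sub_eq_zero]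
      exact (if_pos (by omega)).symm
    have h2 : T = (Q - Q.plus) * Δ := by rw [sub_mul, hQ]
    rw [h2]
    exact (mul_le h1 hm.2).mono (by omega)
  have hTf : ∀ s, app T (f s) = 0 := fun s => by
    rw [app_sub, hPf, app_mul (isDiff_plus Q) hΔ, hΔf, app_zero, sub_zero]
  -- The `M` coefficients of the remainder solve the homogeneous linear system with the Wronskian
  -- matrix; they are listed from the top order down to match its columns.
  have hvec : (fun j : Fin M => T.coeff ((M - 1 - j : ℕ) : ℤ)) = 0 := by
    refine Matrix.eq_zero_of_mulVec_eq_zero hf ?_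
    funext s
    have h1 := hTf s
    rw [app_eq_sum hTle, ← Finset.sum_range_reflect, Finset.sum_range] at h1
    rw [Pi.zero_apply, ← h1]
    simp only [Matrix.mulVec, dotProduct, Matrix.of_apply, mul_comm]
  have hT0 : T = 0 := by
    ext1
    funext k
    rcases lt_or_ge k 0 with h | h
    · exact hTd k h
    · rcases lt_or_ge ((M : ℤ) - 1) k with h' | h'
      · exact hTle k h'
      · have := congrFun hvec ⟨M - 1 - k.toNat, by omega⟩
        simp only [Pi.zero_apply] at this
        rw [show ((M - 1 - (M - 1 - k.toNat) : ℕ) : ℤ) = k by omega] at this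
        exact this
  exact sub_eq_zero.1 hT0

end PDO

/-! ### Stable limits -/

theorem wt_add (c d : ℕ+ →₀ ℕ) : wt (c + d) = wt c + wt d :=
  Finsupp.sum_add_index' (fun _ => rfl) fun _ _ _ => mul_add _ _ _

theorem wt_single (i : ℕ+) (m : ℕ) : wt (Finsupp.single i m) = i * m :=
  Finsupp.sum_single_index rfl

theorem wt_zero : wt 0 = 0 := rfl

open Filter

/-- The ideal of series without terms of degree at most `Q`. -/
def highIdeal (Q : ℕ) : Ideal R where
  carrier := {f | ∀ d, wt d ≤ Q → MvPowerSeries.coeff d f = 0}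
  add_mem' hf hg d hd := by rw [map_add, hf d hd, hg d hd, add_zero]
  zero_mem' d _ := map_zero _
  smul_mem' c f hf d hd := by
    rw [smul_eq_mul, MvPowerSeries.coeff_mul]
    refine Finset.sum_eq_zero fun p hp => ?_
    rw [Finset.HasAntidiagonal.mem_antidiagonal] at hp
    rw [hf p.2 (by rw [← hp, wt_add] at hd; omega), mul_zero]

theorem mem_highIdeal {Q : ℕ} {f : R} :
    f ∈ highIdeal Q ↔ ∀ d, wt d ≤ Q → MvPowerSeries.coeff d f = 0 := Iff.rfl

theorem pd_mem_highIdeal {Q : ℕ} (j : ℕ+) {f : R} (hf : f ∈ highIdeal (Q + j)) :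
    pd j f ∈ highIdeal Q := by
  intro d hd
  rw [MvPowerSeries.coeff_pderiv, hf _ (by rw [wt_add, wt_single]; omega), zero_mul]

theorem isStableLimit_iff {f : ℕ → R} {F : R} :
    IsStableLimit f F ↔ ∀ Q, ∀ᶠ N in atTop, f N - F ∈ highIdeal Q := by
  simp only [IsStableLimit, eventually_atTop, mem_highIdeal, map_sub, sub_eq_zero]

namespace IsStableLimit

variable {f g : ℕ → R} {F G : R}

theorem const (F : R) : IsStableLimit (fun _ => F) F := fun _ => ⟨0, fun _ _ _ _ => rfl⟩

theorem unique (hf : IsStableLimit f F) (hg : IsStableLimit f G) : F = G := by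
  ext d
  obtain ⟨N, hN⟩ := hf (wt d)
  obtain ⟨N', hN'⟩ := hg (wt d)
  rw [← hN _ (le_max_left N N') d le_rfl, hN' _ (le_max_right N N') d le_rfl]

theorem comp_tendsto (hf : IsStableLimit f F) {u : ℕ → ℕ} (hu : Tendsto u atTop atTop) :
    IsStableLimit (fun N => f (u N)) F :=
  isStableLimit_iff.2 fun Q => hu.eventually (isStableLimit_iff.1 hf Q)

theorem add (hf : IsStableLimit f F) (hg : IsStableLimit g G) :
    IsStableLimit (fun N => f N + g N) (F + G) := by
  refine isStableLimit_iff.2 fun Q => ?_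
  filter_upwards [isStableLimit_iff.1 hf Q, isStableLimit_iff.1 hg Q] with N h1 h2
  rw [add_sub_add_comm]
  exact add_mem h1 h2

theorem neg (hf : IsStableLimit f F) : IsStableLimit (fun N => -f N) (-F) := by
  refine isStableLimit_iff.2 fun Q => ?_
  filter_upwards [isStableLimit_iff.1 hf Q] with N h1
  rw [← neg_sub', neg_mem_iff]
  exact h1

theorem sub (hf : IsStableLimit f F) (hg : IsStableLimit g G) :
    IsStableLimit (fun N => f N - g N) (F - G) := by
  simpa only [sub_eq_add_neg] using hf.add hg.neg

theorem mul (hf : IsStableLimit f F) (hg : IsStableLimit g G) :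
    IsStableLimit (fun N => f N * g N) (F * G) := by
  refine isStableLimit_iff.2 fun Q => ?_
  filter_upwards [isStableLimit_iff.1 hf Q, isStableLimit_iff.1 hg Q] with N h1 h2
  rw [show f N * g N - F * G = g N * (f N - F) + F * (g N - G) by ring]
  exact add_mem (Ideal.mul_mem_left _ _ h1) (Ideal.mul_mem_left _ _ h2)

/-- No convergence of `f` is needed, because the series of high degree form an ideal. This controls
inverse operators before their limit is known. -/
theorem mul_zero (f : ℕ → R) (hg : IsStableLimit g 0) : IsStableLimit (fun N => f N * g N) 0 := by
  refine isStableLimit_iff.2 fun Q => ?_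
  filter_upwards [isStableLimit_iff.1 hg Q] with N h1
  rw [sub_zero] at h1 ⊢
  exact Ideal.mul_mem_left _ _ h1

theorem zsmul (k : ℤ) (hf : IsStableLimit f F) : IsStableLimit (fun N => k • f N) (k • F) := by
  simpa only [zsmul_eq_mul] using (const (k : R)).mul hf

theorem sum {ι : Type*} (s : Finset ι) {f : ι → ℕ → R} {F : ι → R}
    (h : ∀ i ∈ s, IsStableLimit (f i) (F i)) :
    IsStableLimit (fun N => ∑ i ∈ s, f i N) (∑ i ∈ s, F i) := by
  classical
  induction s using Finset.induction_on with
  | empty => exact const 0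
  | insert a s ha ih =>
    simp only [Finset.sum_insert ha]
    exact (h a (Finset.mem_insert_self _ _)).add (ih fun i hi => h i (Finset.mem_insert_of_mem hi))

theorem pd (j : ℕ+) (hf : IsStableLimit f F) :
    IsStableLimit (fun N => pd j (f N)) (GelfandDickey.pd j F) := by
  refine isStableLimit_iff.2 fun Q => ?_
  filter_upwards [isStableLimit_iff.1 hf (Q + j)] with N h1
  rw [← map_sub]
  exact pd_mem_highIdeal j h1

theorem D_iterate (l : ℕ) (hf : IsStableLimit f F) :
    IsStableLimit (fun N => D^[l] (f N)) (D^[l] F) := by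
  induction l with
  | zero => exact hf
  | succ l ih => simpa only [Function.iterate_succ_apply'] using ih.pd 1

theorem inv (hf : IsStableLimit f F) (h : ∀ N, MvPowerSeries.constantCoeff (f N) ≠ 0)
    (hF : MvPowerSeries.constantCoeff F ≠ 0) : IsStableLimit (fun N => (f N)⁻¹) F⁻¹ := by
  refine isStableLimit_iff.2 fun Q => ?_
  filter_upwards [isStableLimit_iff.1 hf Q] with N h1
  have e1 := MvPowerSeries.mul_inv_cancel (f N) (h N)
  have e2 := MvPowerSeries.mul_inv_cancel F hF
  rw [show (f N)⁻¹ - F⁻¹ = -((f N)⁻¹ * F⁻¹) * (f N - F) by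
    linear_combination F⁻¹ * e1 - (f N)⁻¹ * e2]
  exact Ideal.mul_mem_left _ _ h1

end IsStableLimit

/-! ### Stable limits of pseudo-differential operators. -/

namespace PDO.IsStableLimit

variable {a b : ℕ → PDO} {A B : PDO} {K K' : ℤ}

theorem const (A : PDO) : PDO.IsStableLimit (fun _ => A) A :=
  fun k => GelfandDickey.IsStableLimit.const (A.coeff k)

theorem coeff_eq_zero (ha : PDO.IsStableLimit a A) {k : ℤ} (h : ∀ N, (a N).coeff k = 0) :
    A.coeff k = 0 := by
  have := ha k
  simp only [h] at this
  exact this.unique (GelfandDickey.IsStableLimit.const 0)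

theorem seqLE (ha : PDO.IsStableLimit a A) (h : ∀ N, SeqLE (a N).coeff K) : SeqLE A.coeff K :=
  fun k hk => ha.coeff_eq_zero fun N => h N k hk

theorem isMonic (ha : PDO.IsStableLimit a A) (h : ∀ N, (a N).IsMonic K) : A.IsMonic K := by
  refine ⟨?_, ha.seqLE fun N => (h N).2⟩
  have := ha K
  simp only [(h _).1] at this
  exact this.unique (GelfandDickey.IsStableLimit.const 1)

theorem isDiff (ha : PDO.IsStableLimit a A) (h : ∀ N, (a N).IsDiff) : A.IsDiff :=
  fun k hk => ha.coeff_eq_zero fun N => h N k hk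

theorem sub (ha : PDO.IsStableLimit a A) (hb : PDO.IsStableLimit b B) :
    PDO.IsStableLimit (fun N => a N - b N) (A - B) := fun k => (ha k).sub (hb k)

theorem add (ha : PDO.IsStableLimit a A) (hb : PDO.IsStableLimit b B) :
    PDO.IsStableLimit (fun N => a N + b N) (A + B) := fun k => (ha k).add (hb k)

theorem tderiv (ha : PDO.IsStableLimit a A) (j : ℕ+) :
    PDO.IsStableLimit (fun N => (a N).tderiv j) (A.tderiv j) := fun k => (ha k).pd j

theorem comp_tendsto (ha : PDO.IsStableLimit a A) {u : ℕ → ℕ} (hu : Tendsto u atTop atTop) :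
    PDO.IsStableLimit (fun N => a (u N)) A := fun k => (ha k).comp_tendsto hu

theorem Dcomp (hb : PDO.IsStableLimit b B) (hbK : ∀ N, SeqLE (b N).coeff K') (i m : ℤ) :
    GelfandDickey.IsStableLimit (fun N => Dcomp i (b N).coeff m)
      (GelfandDickey.Dcomp i B.coeff m) := by
  set L := (K' - m + i + 1).toNat
  rw [Dcomp_eq_sum (hb.seqLE hbK) i m (L := L) (by omega)]
  simp only [fun N => Dcomp_eq_sum (hbK N) i m (L := L) (by omega)]
  exact GelfandDickey.IsStableLimit.sum _ fun l _ => ((hb _).D_iterate l).zsmul _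

theorem mul (ha : PDO.IsStableLimit a A) (haK : ∀ N, SeqLE (a N).coeff K)
    (hb : PDO.IsStableLimit b B) (hbK : ∀ N, SeqLE (b N).coeff K') :
    PDO.IsStableLimit (fun N => a N * b N) (A * B) := by
  intro m
  simp only [coeff_mul, fun N => leibniz_eq_sum (haK N) (hbK N) m le_rfl le_rfl,
    leibniz_eq_sum (ha.seqLE haK) (hb.seqLE hbK) m le_rfl le_rfl]
  exact GelfandDickey.IsStableLimit.sum _ fun i _ => (ha i).mul (hb.Dcomp hbK i m)

theorem mul_zero (haK : ∀ N, SeqLE (a N).coeff K)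
    (hb : PDO.IsStableLimit b 0) (hbK : ∀ N, SeqLE (b N).coeff K') :
    PDO.IsStableLimit (fun N => a N * b N) 0 := by
  intro m
  simp only [coeff_mul, fun N => leibniz_eq_sum (haK N) (hbK N) m le_rfl le_rfl]
  rw [coeff_zero, ← Finset.sum_const_zero (s := Finset.Icc (m - K') K)]
  refine GelfandDickey.IsStableLimit.sum _ fun i _ => ?_
  refine GelfandDickey.IsStableLimit.mul_zero _ ?_
  have h := hb.Dcomp hbK i m
  rwa [show GelfandDickey.Dcomp i (PDO.coeff 0) m = 0 by
    rw [← coeff_Dpow_mul, MulZeroClass.mul_zero, coeff_zero]] at h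

/-- From `a⁻¹ - A⁻¹ = a⁻¹ (A - a) A⁻¹`, where the first factor only needs uniformly bounded order.
-/
theorem inv (ha : PDO.IsStableLimit a A) (h : ∀ N, (a N).IsMonic 0) :
    PDO.IsStableLimit (fun N => (a N)⁻¹) A⁻¹ := by
  have hA := ha.isMonic h
  have h1 : ∀ N, (a N)⁻¹ - A⁻¹ = (a N)⁻¹ * ((A - a N) * A⁻¹) := fun N => by
    rw [sub_mul, mul_sub, hA.mul_inv, ← mul_assoc _ (a N), (h N).inv_mul, mul_one, one_mul]
  have h0 : ∀ N, SeqLE (A - a N).coeff 0 := fun N => sub_le hA.2 (h N).2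
  have h2 : PDO.IsStableLimit (fun N => (A - a N) * A⁻¹) 0 := by
    have := ((const A).sub ha).mul h0 (const A⁻¹) fun _ => hA.inv.2
    rwa [sub_self, zero_mul] at this
  have h3 := mul_zero (fun N => (h N).inv.2) h2 fun N => mul_le (h0 N) hA.inv.2
  have h4 := h3.add (const A⁻¹)
  simpa only [← h1, sub_add_cancel, zero_add] using h4

theorem pow (ha : PDO.IsStableLimit a A) (h : ∀ N, (a N).IsMonic K) (k : ℕ) :
    PDO.IsStableLimit (fun N => a N ^ k) (A ^ k) := by
  induction k with
  | zero => simpa only [pow_zero] using const 1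
  | succ k ih =>
    simp only [pow_succ]
    exact ih.mul (fun N => ((h N).pow k).2) ha fun N => (h N).2

end PDO.IsStableLimit

/-! ### The shift `t ↦ t - [z⁻¹]` -/

open Finset in
theorem sum_antidiagonal_antidiagonal_left {α : Type*} [AddCommMonoid α] (X : ℕ → ℕ → ℕ → α)
    (m : ℕ) :
    ∑ p ∈ antidiagonal m, ∑ q ∈ antidiagonal p.1, X q.1 q.2 p.2 =
      ∑ p ∈ antidiagonal m, ∑ q ∈ antidiagonal p.2, X p.1 q.1 q.2 := by
  rw [sum_sigma', sum_sigma']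
  refine sum_nbij' (fun x => ⟨(x.2.1, x.2.2 + x.1.2), (x.2.2, x.1.2)⟩)
    (fun x => ⟨(x.1.1 + x.2.1, x.2.2), (x.1.1, x.2.1)⟩) ?_ ?_ ?_ ?_ ?_ <;>
  · rintro ⟨⟨a, b⟩, ⟨c, d⟩⟩
    simp only [mem_sigma, HasAntidiagonal.mem_antidiagonal]
    rintro ⟨h1, h2⟩
    first
      | (subst h2; rfl)
      | (subst h2; exact ⟨by omega, trivial⟩)
      | trivial

open Finset in
theorem sum_antidiagonal_antidiagonal_right {α : Type*} [AddCommMonoid α] (X : ℕ → ℕ → ℕ → α)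
    (m : ℕ) :
    ∑ p ∈ antidiagonal m, ∑ q ∈ antidiagonal p.2, X q.1 p.1 q.2 =
      ∑ p ∈ antidiagonal m, ∑ q ∈ antidiagonal p.2, X p.1 q.1 q.2 := by
  rw [sum_sigma', sum_sigma']
  refine sum_nbij' (fun x => ⟨(x.2.1, x.1.1 + x.2.2), (x.1.1, x.2.2)⟩)
    (fun x => ⟨(x.2.1, x.1.1 + x.2.2), (x.1.1, x.2.2)⟩) ?_ ?_ ?_ ?_ ?_ <;>
  · rintro ⟨⟨a, b⟩, ⟨c, d⟩⟩
    simp only [mem_sigma, HasAntidiagonal.mem_antidiagonal]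
    rintro ⟨h1, h2⟩
    first
      | (subst h2; rfl)
      | (subst h2; exact ⟨by omega, trivial⟩)
      | trivial

theorem mul_le_wt (c : ℕ+ →₀ ℕ) (i : ℕ+) : (i : ℕ) * c i ≤ wt c := by
  by_cases h : i ∈ c.support
  · exact Finset.single_le_sum (f := fun i : ℕ+ => (i : ℕ) * c i) (fun _ _ => Nat.zero_le _) h
  · rw [Finsupp.notMem_support_iff.1 h, mul_zero]
    exact Nat.zero_le _

theorem wt_eq_sum {c : ℕ+ →₀ ℕ} {m : ℕ} (h : wt c ≤ m) :
    wt c = ∑ k ∈ Finset.range m, (k + 1) * c k.succPNat := by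
  rw [wt, Finsupp.sum]
  symm
  refine Finset.sum_of_injOn (g := fun i : ℕ+ => (i : ℕ) * c i) (s := Finset.range m)
    (t := c.support ∪ (Finset.range m).image Nat.succPNat) Nat.succPNat
    Nat.succPNat_injective.injOn (fun k hk => ?_) (fun i hi hi' => ?_) (fun k _ => rfl) |>.trans ?_
  · simp only [Finset.coe_union, Finset.coe_image, Set.mem_union]
    exact Or.inr ⟨k, hk, rfl⟩
  · by_contra h0
    have h1 := mul_le_wt c i
    have h2 : 0 < c i := Nat.pos_of_ne_zero (right_ne_zero_of_mul h0)
    have h3 : (i : ℕ) ≤ m := (Nat.le_mul_of_pos_right _ h2).trans (h1.trans h)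
    exact hi' ⟨i.natPred, by simpa using (by have := i.natPred_add_one; omega),
      PNat.succPNat_natPred i⟩
  · symm
    refine Finset.sum_subset Finset.subset_union_left fun i _ hi => ?_
    rw [Finsupp.notMem_support_iff.1 hi, mul_zero]

/-- Such an exponent lives on indices at most `m` with values at most `m`. Finiteness makes the
`finsum` in `miwa` an honest sum rather than its default value. -/
theorem finite_wt_eq (m : ℕ) : {c : ℕ+ →₀ ℕ | wt c = m}.Finite := by
  refine (Set.finite_Iic (∑ k ∈ Finset.range m, Finsupp.single k.succPNat m)).subset ?_
  intro c hc i
  have h1 := mul_le_wt c i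
  rw [Set.mem_ofPred_eq] at hc
  rcases Nat.eq_zero_or_pos (c i) with h0 | h0
  · rw [h0]; exact Nat.zero_le _
  have h2 : (i : ℕ) ≤ m := (Nat.le_mul_of_pos_right _ h0).trans (h1.trans hc.le)
  have h3 : c i ≤ m := (Nat.le_mul_of_pos_left _ i.pos).trans (h1.trans hc.le)
  rw [Finsupp.finsetSum_apply]
  refine h3.trans ?_
  have h4 : i.natPred ∈ Finset.range m := by
    have := i.natPred_add_one
    simp only [Finset.mem_range]; omega
  refine le_trans ?_ (Finset.single_le_sum (f := fun k : ℕ => Finsupp.single k.succPNat m i)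
    (fun _ _ => Nat.zero_le _) h4)
  simp

/-- The monomials of degree `m`. -/
def monomialsOfWt (m : ℕ) : Finset (ℕ+ →₀ ℕ) := (finite_wt_eq m).toFinset

theorem mem_monomialsOfWt {m : ℕ} {c : ℕ+ →₀ ℕ} : c ∈ monomialsOfWt m ↔ wt c = m := by
  simp [monomialsOfWt]

/-- The coefficient of `t ^ d s ^ c` in `∏ (tᵢ - sᵢ / i) ^ (dᵢ + cᵢ)`. -/
def shiftCoeff (d c : ℕ+ →₀ ℕ) : ℂ :=
  c.prod fun i k => ((d i + k).choose k : ℂ) * (-1 / (i : ℂ)) ^ k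

theorem coeff_miwa (f : R) (m : ℕ) (d : ℕ+ →₀ ℕ) :
    MvPowerSeries.coeff d (miwa f m) =
      ∑ c ∈ monomialsOfWt m, MvPowerSeries.coeff (d + c) f * shiftCoeff d c := by
  change (∑ᶠ (c : ℕ+ →₀ ℕ) (_ : c ∈ {c | wt c = m}), MvPowerSeries.coeff (d + c) f *
    shiftCoeff d c) = _
  rw [finsum_mem_eq_finite_toFinset_sum _ (finite_wt_eq m)]
  rfl

theorem shiftCoeff_add_single (d c : ℕ+ →₀ ℕ) (i : ℕ+) :
    (i : ℂ) * (c i + 1) * shiftCoeff d (c + Finsupp.single i 1) =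
      -((d i + c i + 1) * shiftCoeff d c) := by
  have hg : ∀ j ∈ insert i c.support, ((d j + 0).choose 0 : ℂ) * (-1 / (j : ℂ)) ^ 0 = 1 := by simp
  rw [shiftCoeff, shiftCoeff, Finsupp.prod_of_support_subset (s := insert i c.support) _ ?_ _ hg,
    Finsupp.prod_of_support_subset (s := insert i c.support) _ (Finset.subset_insert _ _) _ hg,
    ← Finset.mul_prod_erase _ _ (Finset.mem_insert_self i _),
    ← Finset.mul_prod_erase _ (fun j => ((d j + c j).choose (c j) : ℂ) * (-1 / (j : ℂ)) ^ c j)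
      (Finset.mem_insert_self i _)]
  · have h1 : ∀ j ∈ (insert i c.support).erase i, (c + Finsupp.single i 1 : ℕ+ →₀ ℕ) j = c j := by
      intro j hj
      rw [Finsupp.add_apply, Finsupp.single_eq_of_ne (Finset.ne_of_mem_erase hj), add_zero]
    rw [Finset.prod_congr rfl fun j hj => by rw [h1 j hj]]
    have h2 : (c + Finsupp.single i 1 : ℕ+ →₀ ℕ) i = c i + 1 := by simp
    have h3 : (((d i + c i + 1).choose (c i + 1) : ℕ) : ℂ) * (c i + 1) =
        (d i + c i + 1) * ((d i + c i).choose (c i) : ℕ) := by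
      exact_mod_cast (Nat.add_one_mul_choose_eq (d i + c i) (c i)).symm
    have h4 : (i : ℂ) ≠ 0 := by exact_mod_cast i.ne_zero
    have h5 : (i : ℂ) * (-1 / i) = -1 := by field_simp
    rw [h2, ← add_assoc, pow_succ]
    linear_combination (-1 / (i : ℂ)) ^ c i * (∏ x ∈ (insert i c.support).erase i,
      ((d x + c x).choose (c x) : ℂ) * (-1 / (x : ℂ)) ^ c x) *
      ((i : ℂ) * (-1 / i) * h3 + (d i + c i + 1) * ((d i + c i).choose (c i) : ℕ) * h5)
  · refine Finsupp.support_add.trans ?_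
    intro j hj
    rw [Finset.mem_union] at hj
    rcases hj with hj | hj
    · exact Finset.mem_insert_of_mem hj
    · rw [Finset.mem_singleton.1 (Finsupp.support_single_subset hj)]
      exact Finset.mem_insert_self _ _

/-- The chain rule for `d/dx` of `f(t - [x])`: the `i`-th argument `t_i - x ^ i / i` has derivative
`-x ^ (i-1)`. This recursion determines the shift and replaces explicit formulas below. -/
theorem miwa_succ (f : R) (m : ℕ) :
    ((m + 1 : ℕ) : ℂ) • miwa f (m + 1) =
      -∑ p ∈ Finset.HasAntidiagonal.antidiagonal m, miwa (pd p.1.succPNat f) p.2 := by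
  ext d
  rw [MvPowerSeries.coeff_smul, coeff_miwa, map_neg, map_sum,
    Finset.Nat.sum_antidiagonal_eq_sum_range_succ_mk, Finset.mul_sum]
  -- Euler's identity: the factor `m + 1` is the weight `∑ i cᵢ`, which is distributed over the
  -- variables.
  have h1 : ∀ c ∈ monomialsOfWt (m + 1), ((m + 1 : ℕ) : ℂ) *
      (MvPowerSeries.coeff (d + c) f * shiftCoeff d c) = ∑ k ∈ Finset.range (m + 1),
        MvPowerSeries.coeff (d + c) f * (((k.succPNat : ℕ) : ℂ) * c k.succPNat *
          shiftCoeff d c) := by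
    intro c hc
    rw [mem_monomialsOfWt] at hc
    have h2 : ((m + 1 : ℕ) : ℂ) =
        ∑ k ∈ Finset.range (m + 1), ((k.succPNat : ℕ) : ℂ) * c k.succPNat := by
      conv_lhs => rw [← hc, wt_eq_sum hc.le]
      simp only [Nat.cast_sum, Nat.cast_mul, Nat.succPNat_coe, Nat.succ_eq_add_one]
    rw [← Finset.mul_sum, ← Finset.sum_mul, ← h2]
    ring
  rw [Finset.sum_congr rfl h1, Finset.sum_comm, ← Finset.sum_neg_distrib]
  refine Finset.sum_congr rfl fun k hk => ?_
  rw [Finset.mem_range] at hk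
  dsimp only
  rw [coeff_miwa, ← Finset.sum_neg_distrib]
  set i := k.succPNat
  have hi : (i : ℕ) = k + 1 := rfl
  symm
  refine Finset.sum_of_injOn (fun c => c + Finsupp.single i 1) (add_left_injective _).injOn
    ?_ ?_ ?_
  · intro c hc
    rw [Finset.mem_coe, mem_monomialsOfWt] at hc ⊢
    rw [wt_add, wt_single, hc]
    omega
  · intro c hc hc'
    rw [mem_monomialsOfWt] at hc
    have h0 : c i = 0 := by
      by_contra h0
      have hle : Finsupp.single i 1 ≤ c := by
        rw [Finsupp.single_le_iff]; omega
      refine hc' ⟨c - Finsupp.single i 1, ?_, tsub_add_cancel_of_le hle⟩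
      have := wt_add (c - Finsupp.single i 1) (Finsupp.single i 1)
      rw [tsub_add_cancel_of_le hle, wt_single] at this
      rw [Finset.mem_coe, mem_monomialsOfWt]
      omega
    rw [h0]
    simp
  · intro c _
    rw [MvPowerSeries.coeff_pderiv, ← add_assoc]
    have := shiftCoeff_add_single d c i
    simp only [Finsupp.add_apply, Finsupp.single_eq_same, Nat.cast_add, Nat.cast_one]
    linear_combination -(MvPowerSeries.coeff (d + c + Finsupp.single i 1) f) * this

theorem miwa_zero (f : R) : miwa f 0 = f := by
  have h : monomialsOfWt 0 = {0} := by
    ext c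
    rw [mem_monomialsOfWt, Finset.mem_singleton]
    refine ⟨fun h => ?_, fun h => by rw [h, wt_zero]⟩
    ext i
    have := mul_le_wt c i
    rw [h] at this
    exact (Nat.mul_eq_zero.1 (Nat.le_zero.1 this)).resolve_left i.ne_zero
  ext d
  rw [coeff_miwa, h, Finset.sum_singleton, add_zero, shiftCoeff, Finsupp.prod_zero_index, mul_one]

theorem miwa_add (f g : R) (m : ℕ) : miwa (f + g) m = miwa f m + miwa g m := by
  ext d
  simp only [coeff_miwa, map_add, add_mul, Finset.sum_add_distrib]

theorem miwa_zero_left (m : ℕ) : miwa 0 m = 0 := by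
  ext d
  simp only [coeff_miwa, map_zero, zero_mul, Finset.sum_const_zero]

/-- Both sides obey the recursion `miwa_succ`, because the time derivatives satisfy the product
rule. -/
theorem miwa_mul (f g : R) (m : ℕ) :
    miwa (f * g) m = ∑ p ∈ Finset.HasAntidiagonal.antidiagonal m, miwa f p.1 * miwa g p.2 := by
  induction m using Nat.strong_induction_on generalizing f g with
  | _ m ih =>
    rcases m with _ | m
    · simp [miwa_zero]
    · have hm : ((m + 1 : ℕ) : ℂ) ≠ 0 := by exact_mod_cast m.succ_ne_zero
      refine smul_right_injective R hm ?_
      dsimp only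
      rw [miwa_succ, Finset.smul_sum]
      have h1 : ∀ p ∈ Finset.HasAntidiagonal.antidiagonal (m + 1),
          ((m + 1 : ℕ) : ℂ) • (miwa f p.1 * miwa g p.2) =
          ((p.1 : ℂ) • miwa f p.1) * miwa g p.2 + miwa f p.1 * ((p.2 : ℂ) • miwa g p.2) := by
        intro p hp
        rw [Finset.HasAntidiagonal.mem_antidiagonal] at hp
        rw [← hp, smul_mul_assoc, mul_smul_comm, ← add_smul, Nat.cast_add]
      have h2 : ∀ p ∈ Finset.HasAntidiagonal.antidiagonal m, miwa (pd p.1.succPNat (f * g)) p.2 =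
          ∑ q ∈ Finset.HasAntidiagonal.antidiagonal p.2, miwa (pd p.1.succPNat f) q.1 * miwa g q.2 +
          ∑ q ∈ Finset.HasAntidiagonal.antidiagonal p.2, miwa f q.1 * miwa (pd p.1.succPNat g) q.2 := by
        intro p hp
        rw [Finset.HasAntidiagonal.mem_antidiagonal] at hp
        rw [pd_mul, miwa_add, ih _ (by omega), ih _ (by omega)]
      rw [Finset.sum_congr rfl h1, Finset.sum_congr rfl h2, Finset.sum_add_distrib,
        Finset.sum_add_distrib, Finset.Nat.sum_antidiagonal_succ,
        Finset.Nat.sum_antidiagonal_succ', ← sum_antidiagonal_antidiagonal_left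
          (fun k a b => miwa (pd k.succPNat f) a * miwa g b),
        ← sum_antidiagonal_antidiagonal_right (fun k a b => miwa f a * miwa (pd k.succPNat g) b)]
      simp only [miwa_succ, Nat.cast_zero, zero_smul, zero_mul, mul_zero, zero_add,
        neg_mul, mul_neg, Finset.sum_neg_distrib, Finset.sum_mul, Finset.mul_sum, neg_add]

theorem miwa_one_succ (m : ℕ) : miwa 1 (m + 1) = 0 := by
  have hm : ((m + 1 : ℕ) : ℂ) ≠ 0 := by exact_mod_cast m.succ_ne_zero
  refine smul_right_injective R hm ?_
  dsimp only
  rw [miwa_succ, smul_zero, neg_eq_zero]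
  refine Finset.sum_eq_zero fun p _ => ?_
  rw [show pd p.1.succPNat (1 : R) = 0 from MvPowerSeries.pderiv_one, miwa_zero_left]

/-- `τ ↦ τ(t - [x])`, as a series in `x = z⁻¹`. -/
def miwaHom : R →+* PowerSeries R where
  toFun f := PowerSeries.mk (miwa f)
  map_one' := by
    ext1 m
    rw [PowerSeries.coeff_mk, PowerSeries.coeff_one]
    rcases m with _ | m
    · rw [miwa_zero, if_pos rfl]
    · rw [miwa_one_succ, if_neg m.succ_ne_zero]
  map_mul' f g := by
    ext1 m
    simp only [PowerSeries.coeff_mul, PowerSeries.coeff_mk, miwa_mul]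
  map_zero' := by
    ext1 m
    rw [PowerSeries.coeff_mk, miwa_zero_left, map_zero]
  map_add' f g := by
    ext1 m
    simp only [map_add, PowerSeries.coeff_mk, miwa_add]

theorem coeff_miwaHom (f : R) (m : ℕ) : PowerSeries.coeff m (miwaHom f) = miwa f m :=
  PowerSeries.coeff_mk m (miwa f)

/-- The shift acts on sequences with `∂g_a/∂t_j = g_{a-j}` by `g_a ↦ g_a - x g_{a-1}`. -/
theorem miwaHom_of_pd {g : ℤ → R} (hg : ∀ (j : ℕ+) (a : ℤ), pd j (g a) = g (a - (j : ℕ)))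
    (a : ℤ) :
    miwaHom (g a) = PowerSeries.C (g a) - PowerSeries.X * PowerSeries.C (g (a - 1)) := by
  have h1 : ∀ a, miwa (g a) 1 = -g (a - 1) := fun a => by
    have := miwa_succ (g a) 0
    simpa [miwa_zero, hg] using this
  have h2 : ∀ m a, miwa (g a) (m + 2) = 0 := by
    intro m
    induction m using Nat.strong_induction_on with
    | _ m ih =>
      intro a
      have hm : ((m + 2 : ℕ) : ℂ) ≠ 0 := by exact_mod_cast (m + 1).succ_ne_zero
      refine smul_right_injective R hm ?_
      dsimp only
      rw [miwa_succ, smul_zero, neg_eq_zero, Finset.Nat.sum_antidiagonal_succ',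
        -- By induction only shifts of order `0` and `1` survive in the recursion. They contribute
        -- `g (a - (m + 2))` and its negative, which cancel.
        Finset.sum_congr rfl (g := fun p : ℕ × ℕ => if p.2 = 0 then -g (a - (m + 2)) else 0)]
      · rw [Finset.sum_ite, Finset.sum_const_zero, add_zero, Finset.sum_const,
          miwa_zero, hg]
        have : (Finset.HasAntidiagonal.antidiagonal m).filter (fun p => p.2 = 0) = {(m, 0)} := by
          ext ⟨x, y⟩
          simp only [Finset.mem_filter, Finset.HasAntidiagonal.mem_antidiagonal,
            Finset.mem_singleton, Prod.mk.injEq]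
          omega
        rw [this, Finset.card_singleton, one_smul, Nat.succPNat_coe]
        push_cast
        rw [show a - ((m : ℤ) + 2) = a - (m + 1 + 1) by ring]
        exact add_neg_cancel _
      · rintro ⟨x, y⟩ hp
        rw [Finset.HasAntidiagonal.mem_antidiagonal] at hp
        dsimp only at hp ⊢
        rw [hg]
        rcases y with _ | y
        · rw [if_pos rfl, h1, ← hp, Nat.succPNat_coe]
          congr 2
          push_cast
          ring
        · rw [if_neg y.succ_ne_zero]
          exact ih y (by omega) _
  ext1 m
  rw [coeff_miwaHom, map_sub, PowerSeries.coeff_C]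
  rcases m with _ | _ | m
  · simp [miwa_zero]
  · rw [h1, PowerSeries.coeff_succ_X_mul, PowerSeries.coeff_C]
    simp
  · rw [h2, PowerSeries.coeff_succ_X_mul, PowerSeries.coeff_C]
    simp

theorem IsStableLimit.miwa {f : ℕ → R} {F : R} (hf : IsStableLimit f F) (m : ℕ) :
    IsStableLimit (fun N => miwa (f N) m) (GelfandDickey.miwa F m) := by
  intro Q
  obtain ⟨N₀, h⟩ := hf (Q + m)
  refine ⟨N₀, fun N hN d hd => ?_⟩
  rw [coeff_miwa, coeff_miwa]
  refine Finset.sum_congr rfl fun c hc => ?_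
  rw [mem_monomialsOfWt] at hc
  rw [h N hN _ (by rw [wt_add]; omega)]

/-! ### The coefficients of `exp ξ(t,z) ∑ c_l z ^ l` -/

/-- The product of the inverse factorials of the exponents. -/
def invFactorial (d : ℕ+ →₀ ℕ) : ℂ := d.prod fun _ m => ((m.factorial : ℂ))⁻¹

theorem invFactorial_add_single (d : ℕ+ →₀ ℕ) (i : ℕ+) :
    invFactorial (d + Finsupp.single i 1) * (d i + 1) = invFactorial d := by
  have hg : ∀ j ∈ insert i d.support, ((Nat.factorial 0 : ℂ))⁻¹ = 1 := by simp
  rw [invFactorial, invFactorial,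
    Finsupp.prod_of_support_subset (s := insert i d.support) _ ?_ _ hg,
    Finsupp.prod_of_support_subset (s := insert i d.support) _ (Finset.subset_insert _ _) _ hg,
    ← Finset.mul_prod_erase _ _ (Finset.mem_insert_self i _),
    ← Finset.mul_prod_erase _ (fun j => ((d j).factorial : ℂ)⁻¹) (Finset.mem_insert_self i _)]
  · have h1 : ∀ j ∈ (insert i d.support).erase i, (d + Finsupp.single i 1 : ℕ+ →₀ ℕ) j = d j := by
      intro j hj
      rw [Finsupp.add_apply, Finsupp.single_eq_of_ne (Finset.ne_of_mem_erase hj), add_zero]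
    rw [Finset.prod_congr rfl fun j hj => by rw [h1 j hj]]
    have h2 : (d + Finsupp.single i 1 : ℕ+ →₀ ℕ) i = d i + 1 := by simp
    have h3 : (d i + 1 : ℂ) ≠ 0 := by exact_mod_cast (d i).succ_ne_zero
    have h4 : ((d i).factorial : ℂ) ≠ 0 := by exact_mod_cast (d i).factorial_ne_zero
    rw [h2, Nat.factorial_succ, Nat.cast_mul, Nat.cast_succ]
    field_simp
  · refine Finsupp.support_add.trans fun j hj => ?_
    rw [Finset.mem_union] at hj
    rcases hj with hj | hj
    · exact Finset.mem_insert_of_mem hj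
    · rw [Finset.mem_singleton.1 (Finsupp.support_single_subset hj)]
      exact Finset.mem_insert_self _ _

/-- The coefficient of `z ^ a` in `exp ξ(t,z) ∑ c_l z ^ l`. -/
def expCoeff (c : ℤ → ℂ) (a : ℤ) : R := fun d => invFactorial d * c (a - wt d)

theorem coeff_expCoeff (c : ℤ → ℂ) (a : ℤ) (d : ℕ+ →₀ ℕ) :
    MvPowerSeries.coeff d (expCoeff c a) = invFactorial d * c (a - wt d) := rfl

/-- Because `∂/∂t_j` multiplies `exp ξ` by `z ^ j`. -/
theorem pd_expCoeff (c : ℤ → ℂ) (j : ℕ+) (a : ℤ) :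
    pd j (expCoeff c a) = expCoeff c (a - (j : ℕ)) := by
  ext d
  rw [MvPowerSeries.coeff_pderiv, coeff_expCoeff, coeff_expCoeff, ← invFactorial_add_single d j,
    wt_add, wt_single, show a - ((wt d + j * 1 : ℕ) : ℤ) = a - (j : ℕ) - wt d by push_cast; ring]
  ring

theorem D_iterate_expCoeff (c : ℤ → ℂ) (k : ℕ) (a : ℤ) :
    D^[k] (expCoeff c a) = expCoeff c (a - k) := by
  induction k generalizing a with
  | zero => simp
  | succ k ih =>
    rw [Function.iterate_succ_apply, D, pd_expCoeff, ih]
    congr 1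
    push_cast
    ring

/-! ### The `τ`-function -/

/-- The `M × M` determinant `det [∮ z ^ (-i) exp ξ(t,z) ω_j dz]`, where `ω_j = ∑ c_{j,l} z ^ l`. -/
def tauDet (c : ℕ → ℤ → ℂ) (M : ℕ) : R :=
  (Matrix.of fun i j : Fin M => expCoeff (c j) (i : ℕ)).det

/-- The elementary Schur polynomials. -/
def schur (k : ℕ) : R := expCoeff (fun l => if l = 0 then 1 else 0) k

theorem coeff_schur (k : ℕ) (d : ℕ+ →₀ ℕ) :
    MvPowerSeries.coeff d (schur k) = if wt d = k then invFactorial d else 0 := by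
  rw [schur, coeff_expCoeff]
  by_cases h : wt d = k
  · simp [h]
  · rw [if_neg (by omega), if_neg h, mul_zero]

theorem schur_zero : schur 0 = 1 := by
  ext d
  rw [coeff_schur, MvPowerSeries.coeff_one]
  by_cases h : d = 0
  · subst h
    simp [wt_zero, invFactorial]
  · rw [if_neg h, if_neg]
    intro h0
    refine h (Finsupp.ext fun i => ?_)
    have := mul_le_wt d i
    rw [h0] at this
    exact (Nat.mul_eq_zero.1 (Nat.le_zero.1 this)).resolve_left i.ne_zero

/-- The coefficients of `exp (-ξ(t,z))`. -/
def schurInv (k : ℕ) : R :=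
  PowerSeries.coeff k (PowerSeries.invOfUnit (PowerSeries.mk schur) 1)

theorem mk_schurInv_mul : PowerSeries.mk schurInv * PowerSeries.mk schur = 1 := by
  have h : PowerSeries.mk schurInv = PowerSeries.invOfUnit (PowerSeries.mk schur) 1 := by
    ext1 k
    rw [PowerSeries.coeff_mk, schurInv]
  rw [h, mul_comm]
  refine PowerSeries.mul_invOfUnit _ _ ?_
  rw [← PowerSeries.coeff_zero_eq_constantCoeff_apply, PowerSeries.coeff_mk, schur_zero,
    Units.val_one]

theorem schurInv_zero : schurInv 0 = 1 := by
  have h := congrArg (PowerSeries.coeff 0) mk_schurInv_mul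
  simpa [PowerSeries.coeff_mul, schur_zero] using h

/-- All terms of `f` have degree at least `k`. -/
def HasLowDegree (k : ℕ) (f : R) : Prop := ∀ d, wt d < k → MvPowerSeries.coeff d f = 0

theorem HasLowDegree.mul {j k : ℕ} {f g : R} (hf : HasLowDegree j f) (hg : HasLowDegree k g) :
    HasLowDegree (j + k) (f * g) := by
  intro d hd
  rw [MvPowerSeries.coeff_mul]
  refine Finset.sum_eq_zero fun p hp => ?_
  rw [Finset.HasAntidiagonal.mem_antidiagonal] at hp
  rw [← hp, wt_add] at hd
  rcases lt_or_ge (wt p.1) j with h | h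
  · rw [hf _ h, zero_mul]
  · rw [hg _ (by omega), mul_zero]

theorem HasLowDegree.sum {ι : Type*} {s : Finset ι} {k : ℕ} {f : ι → R}
    (h : ∀ i ∈ s, HasLowDegree k (f i)) : HasLowDegree k (∑ i ∈ s, f i) := by
  intro d hd
  rw [map_sum]
  exact Finset.sum_eq_zero fun i hi => h i hi d hd

theorem hasLowDegree_schur (k : ℕ) : HasLowDegree k (schur k) := by
  intro d hd
  rw [coeff_schur, if_neg (by omega)]

theorem hasLowDegree_schurInv (k : ℕ) : HasLowDegree k (schurInv k) := by
  induction k using Nat.strong_induction_on with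
  | _ k ih =>
    rcases k with _ | k
    · exact fun d hd => absurd hd (Nat.not_lt_zero _)
    · have h := congrArg (PowerSeries.coeff (k + 1)) mk_schurInv_mul
      rw [PowerSeries.coeff_mul, Finset.Nat.sum_antidiagonal_succ', PowerSeries.coeff_one,
        if_neg k.succ_ne_zero] at h
      simp only [PowerSeries.coeff_mk, schur_zero, mul_one] at h
      rw [eq_neg_of_add_eq_zero_left h]
      intro d hd
      rw [map_neg, neg_eq_zero]
      refine HasLowDegree.sum (k := k + 1) (fun p hp => ?_) d hd
      rw [Finset.HasAntidiagonal.mem_antidiagonal] at hp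
      have := (ih p.1 (by omega)).mul (hasLowDegree_schur (p.2 + 1))
      rwa [show p.1 + (p.2 + 1) = k + 1 by omega] at this

/-- Multiplication by `exp (-ξ)` of the part of nonnegative powers of `exp ξ ∑ c_l z ^ l`. -/
theorem sum_schurInv_mul_expCoeff (c : ℤ → ℂ) (M : ℕ) :
    ∑ p ∈ Finset.HasAntidiagonal.antidiagonal M, schurInv p.1 * expCoeff c (p.2 : ℕ) -
      MvPowerSeries.C (c M) ∈ highIdeal M := by
  -- Without the negative powers of `c`, the nonnegative part of the product is exactly `exp ξ ·
  -- ∑_{l ≥ 0} c_l z ^ l`, and multiplying by `exp (-ξ)` returns `c`.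
  set c' : ℤ → ℂ := fun l => if l < 0 then c l else 0
  have hp : PowerSeries.mk (fun b : ℕ => expCoeff c b - expCoeff c' b) =
      PowerSeries.mk schur * PowerSeries.mk fun l : ℕ => (MvPowerSeries.C (c l) : R) := by
    ext1 b
    rw [PowerSeries.coeff_mul, PowerSeries.coeff_mk]
    ext d
    simp only [PowerSeries.coeff_mk, map_sum, map_sub, MvPowerSeries.coeff_mul_C, coeff_expCoeff,
      coeff_schur]
    rcases le_or_gt (wt d) b with h | h
    · rw [Finset.sum_eq_single_of_mem (wt d, b - wt d)
        (by rw [Finset.HasAntidiagonal.mem_antidiagonal]; omega)]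
      · have : c' (b - wt d) = 0 := if_neg (by omega)
        rw [this, if_pos rfl, mul_zero, sub_zero, Nat.cast_sub h]
      · rintro ⟨x, y⟩ hxy hne
        rw [Finset.HasAntidiagonal.mem_antidiagonal] at hxy
        dsimp only at hxy ⊢
        rw [if_neg, zero_mul]
        rintro rfl
        exact hne (Prod.ext rfl (by dsimp only; omega))
    · have : c' (b - wt d) = c (b - wt d) := if_pos (by omega)
      rw [this, sub_self, Finset.sum_eq_zero]
      rintro ⟨x, y⟩ hxy
      rw [Finset.HasAntidiagonal.mem_antidiagonal] at hxy
      dsimp only at hxy ⊢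
      rw [if_neg (by omega), zero_mul]
  have h1 := congrArg (fun f => PowerSeries.coeff M (PowerSeries.mk schurInv * f)) hp
  rw [← mul_assoc, mk_schurInv_mul, one_mul, PowerSeries.coeff_mk, PowerSeries.coeff_mul] at h1
  simp only [PowerSeries.coeff_mk, mul_sub, Finset.sum_sub_distrib] at h1
  rw [← h1, sub_sub_cancel]
  intro d hd
  refine HasLowDegree.sum (k := M + 1) (fun p hp => ?_) d (by omega)
  rw [Finset.HasAntidiagonal.mem_antidiagonal] at hp
  -- Lifting a strictly negative power of `z` to `z ^ b` costs degree at least `b + 1` in `t`.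
  have h2 : HasLowDegree (p.2 + 1) (expCoeff c' p.2) := fun d hd => by
    rw [coeff_expCoeff, show c' (p.2 - wt d) = 0 from if_neg (by omega), mul_zero]
  have := (hasLowDegree_schurInv p.1).mul h2
  rwa [← add_assoc, hp] at this

/-- `c_j = z ^ j + (lower powers of z)` for all `j`. -/
structure IsUnitriangular (c : ℕ → ℤ → ℂ) : Prop where
  eq_zero : ∀ (j : ℕ) (l : ℤ), (j : ℤ) < l → c j l = 0
  eq_one : ∀ j : ℕ, c j j = 1

/-- Adding multiples of the other rows to the last one, with the coefficients of `exp (-ξ)`, turns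
it into `(c_{j,M})_j = (0, …, 0, 1)` up to terms of degree greater than `M`. Expansion along that
row leaves the determinant of size `M`. -/
theorem tauDet_succ_sub {c : ℕ → ℤ → ℂ} (hc : IsUnitriangular c) (M : ℕ) :
    tauDet c (M + 1) - tauDet c M ∈ highIdeal M := by
  set A : Matrix (Fin (M + 1)) (Fin (M + 1)) R := Matrix.of fun i j => expCoeff (c j) (i : ℕ)
  set v : Fin (M + 1) → R := ∑ k : Fin (M + 1), schurInv (M - k) • A k
  -- The last row enters `v` with coefficient `schurInv 0 = 1`, so the determinant is unchanged.
  have hA : tauDet c (M + 1) = (A.updateRow (Fin.last M) v).det := by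
    have := Matrix.det_updateRow_sum A (Fin.last M) fun k => schurInv (M - k)
    simp only [Fin.val_last, Nat.sub_self, schurInv_zero, one_smul] at this
    exact this.symm
  have hv : ∀ j, v j - (if j = Fin.last M then 1 else 0) ∈ highIdeal M := by
    intro j
    have h1 : v j = ∑ p ∈ Finset.HasAntidiagonal.antidiagonal M,
        schurInv p.1 * expCoeff (c j) (p.2 : ℕ) := by
      rw [← Finset.Nat.sum_antidiagonal_swap, Finset.Nat.sum_antidiagonal_eq_sum_range_succ_mk,
        Finset.sum_range]
      simp only [v, Finset.sum_apply, Pi.smul_apply, smul_eq_mul]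
      rfl
    have h2 : (if j = Fin.last M then 1 else 0 : R) = MvPowerSeries.C (c j M) := by
      split_ifs with h
      · rw [h, Fin.val_last, hc.eq_one, map_one]
      · rw [hc.eq_zero, map_zero]
        have := Fin.val_lt_last h
        omega
    rw [h1, h2]
    exact sum_schurInv_mul_expCoeff (c j) M
  have hsub : ∀ j : Fin (M + 1), (A.updateRow (Fin.last M) v).submatrix (Fin.last M).succAbove
      j.succAbove = A.submatrix Fin.castSucc j.succAbove := by
    intro j
    ext1 i k
    rw [Matrix.submatrix_apply, Matrix.submatrix_apply, Fin.succAbove_last,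
      Matrix.updateRow_ne (Fin.castSucc_lt_last i).ne]
  have hM : tauDet c M = (A.submatrix Fin.castSucc (Fin.last M).succAbove).det := by
    rw [Fin.succAbove_last]
    rfl
  rw [hA, Matrix.det_succ_row _ (Fin.last M)]
  have h3 : tauDet c M = ∑ j : Fin (M + 1), (-1) ^ ((Fin.last M : ℕ) + (j : ℕ)) *
      (if j = Fin.last M then 1 else 0) * (A.submatrix Fin.castSucc j.succAbove).det := by
    rw [Finset.sum_eq_single_of_mem (Fin.last M) (Finset.mem_univ _)]
    · rw [if_pos rfl, ← hM, ← two_mul, pow_mul, neg_one_sq, one_pow, one_mul, one_mul]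
    · intro j _ hj
      rw [if_neg hj, mul_zero, zero_mul]
  rw [h3, ← Finset.sum_sub_distrib]
  refine sum_mem fun j _ => ?_
  rw [hsub, Matrix.updateRow_self, ← sub_mul, ← mul_sub]
  exact Ideal.mul_mem_right _ _ (Ideal.mul_mem_left _ _ (hv j))

theorem coeff_tauDet {c : ℕ → ℤ → ℂ} (hc : IsUnitriangular c) {d : ℕ+ →₀ ℕ} {M : ℕ}
    (h : wt d ≤ M) :
    MvPowerSeries.coeff d (tauDet c M) = MvPowerSeries.coeff d (tauDet c (wt d)) := by
  induction M, h using Nat.le_induction with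
  | base => rfl
  | succ M h ih =>
    rw [← ih, ← sub_eq_zero, ← map_sub]
    exact tauDet_succ_sub hc M d h

/-- The stable limit of the determinants `tauDet c M`. -/
def tauLimit (c : ℕ → ℤ → ℂ) : R := fun d => MvPowerSeries.coeff d (tauDet c (wt d))

theorem isStableLimit_tauDet {c : ℕ → ℤ → ℂ} (hc : IsUnitriangular c) :
    IsStableLimit (tauDet c) (tauLimit c) :=
  fun _ => ⟨_, fun _ hN _ hd => coeff_tauDet hc (hd.trans hN)⟩

theorem constantCoeff_tauDet {c : ℕ → ℤ → ℂ} (hc : IsUnitriangular c) (M : ℕ) :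
    MvPowerSeries.constantCoeff (tauDet c M) = 1 := by
  rw [← MvPowerSeries.coeff_zero_eq_constantCoeff_apply, coeff_tauDet hc (Nat.zero_le M), wt_zero,
    tauDet, Matrix.det_isEmpty, MvPowerSeries.coeff_zero_one]

theorem constantCoeff_tauLimit (c : ℕ → ℤ → ℂ) :
    MvPowerSeries.constantCoeff (tauLimit c) = 1 := by
  rw [← MvPowerSeries.coeff_zero_eq_constantCoeff_apply]
  change MvPowerSeries.coeff 0 (tauDet c (wt 0)) = 1
  rw [wt_zero, tauDet, Matrix.det_isEmpty, MvPowerSeries.coeff_zero_one]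

theorem tauDet_ne_zero {c : ℕ → ℤ → ℂ} (hc : IsUnitriangular c) (M : ℕ) : tauDet c M ≠ 0 := by
  intro h
  have := constantCoeff_tauDet hc M
  rw [h, map_zero] at this
  exact zero_ne_one this

/-! ### Expansion of the numerator of `Δ` -/

/-- The cofactors of a row put on top of the rows of `B`. -/
def topCofactor {S : Type*} [CommRing S] {M : ℕ} (B : Fin M → Fin (M + 1) → S)
    (j : Fin (M + 1)) : S :=
  (-1) ^ (j : ℕ) * (Matrix.of fun i k => B i (j.succAbove k)).det

theorem det_cons_eq_sum {S : Type*} [CommRing S] {M : ℕ} (B : Fin M → Fin (M + 1) → S)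
    (v : Fin (M + 1) → S) :
    (Matrix.of (Fin.cons v B : Fin (M + 1) → Fin (M + 1) → S)).det =
      ∑ j, v j * topCofactor B j := by
  rw [Matrix.det_succ_row_zero]
  refine Finset.sum_congr rfl fun j _ => ?_
  rw [topCofactor, mul_comm ((-1) ^ (j : ℕ)), mul_assoc]
  rfl

theorem map_topCofactor {S T : Type*} [CommRing S] [CommRing T] (φ : S →+* T) {M : ℕ}
    (B : Fin M → Fin (M + 1) → S) (j : Fin (M + 1)) :
    topCofactor (fun i k => φ (B i k)) j = φ (topCofactor B j) := by
  rw [topCofactor, topCofactor, map_mul, map_pow, map_neg, map_one, RingHom.map_det]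
  rfl

/-- The rows `(D ^ M f_i, …, D f_i, f_i)` for `f_i = ∮ z ^ (-M) exp ξ ω_i dz`. -/
def wronskianRows (c : ℕ → ℤ → ℂ) (M : ℕ) (i : Fin M) (j : Fin (M + 1)) : R :=
  expCoeff (c i) ((j : ℕ) - 1)

/-- The right side is the determinant with top row `(1, x, …, x ^ M)` over the Wronskian rows.
Subtracting `x` times the preceding column from each column makes the top row `(1, 0, …, 0)`, and
the other entries become `g_a - x g_{a-1}`, the shifted entries of `τ` by `miwaHom_of_pd`. -/
theorem miwaHom_tauDet (c : ℕ → ℤ → ℂ) (M : ℕ) :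
    miwaHom (tauDet c M) =
      ∑ j : Fin (M + 1), PowerSeries.X ^ (j : ℕ) * PowerSeries.C (topCofactor (wronskianRows c M) j)
      := by
  set B : Fin M → Fin (M + 1) → PowerSeries R := fun i k => PowerSeries.C (wronskianRows c M i k)
  set B' : Fin M → Fin (M + 1) → PowerSeries R := fun i => Fin.cons (B i 0) fun k =>
    B i k.succ - PowerSeries.X * B i k.castSucc
  have h1 : (Matrix.of (Fin.cons (fun j => PowerSeries.X ^ (j : ℕ)) B :
      Fin (M + 1) → Fin (M + 1) → PowerSeries R)).det =
      (Matrix.of (Fin.cons (Pi.single 0 1) B' : Fin (M + 1) → Fin (M + 1) → PowerSeries R)).det := by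
    refine Matrix.det_eq_of_forall_col_eq_smul_add_pred (fun _ => PowerSeries.X) ?_ ?_
    · intro i
      refine Fin.cases ?_ (fun i => ?_) i
      · simp
      · simp [B']
    · intro i k
      refine Fin.cases ?_ (fun i => ?_) i
      · simp [pow_succ']
      · simp [B']
  rw [det_cons_eq_sum, det_cons_eq_sum, Finset.sum_eq_single_of_mem
    (f := fun j => (Pi.single 0 1 : Fin (M + 1) → PowerSeries R) j * topCofactor B' j) 0
    (Finset.mem_univ _) (fun j _ hj => by rw [Pi.single_eq_of_ne hj, zero_mul]), Pi.single_eq_same,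
    one_mul, topCofactor, Fin.val_zero, pow_zero, one_mul] at h1
  simp only [← map_topCofactor]
  rw [h1, tauDet, RingHom.map_det, ← Matrix.det_transpose]
  congr 1
  ext1 i k
  simp only [Matrix.transpose_apply, RingHom.mapMatrix_apply, Matrix.map_apply, Matrix.of_apply,
    Fin.zero_succAbove, B', Fin.cons_succ]
  rw [miwaHom_of_pd (pd_expCoeff _)]
  simp [B, wronskianRows]

theorem miwa_tauDet (c : ℕ → ℤ → ℂ) (M m : ℕ) :
    miwa (tauDet c M) m =
      ∑ j : Fin (M + 1), (if m = j then 1 else 0) * topCofactor (wronskianRows c M) j := by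
  rw [← coeff_miwaHom, miwaHom_tauDet, map_sum]
  refine Finset.sum_congr rfl fun j _ => ?_
  rw [PowerSeries.coeff_mul_C, PowerSeries.coeff_X_pow]

/-! ### The truncated operators -/

/-- The Fourier coefficients of the `ω_m`. -/
def omegaCoeff {n : ℕ} [NeZero n] (w : Fin n → H n) (m : ℕ) (l : ℤ) : ℂ :=
  fourierCoeff (omega w m) l

theorem fourierCoeff_fourier_mul (k l : ℤ) (g : UnitAddCircle → ℂ) :
    fourierCoeff (fun θ => fourier k θ * g θ) l = fourierCoeff g (l - k) := by
  simp only [fourierCoeff, smul_eq_mul]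
  congr 1
  funext θ
  rw [← mul_assoc, ← fourier_add, neg_sub, neg_add_eq_sub]

theorem moment_eq_expCoeff (i : ℕ) (g : UnitAddCircle → ℂ) :
    moment i g = expCoeff (fourierCoeff g) (i - 1) := by
  ext d
  change fourierCoeff (fun θ => expXiCoeff d θ * g θ) ((i : ℤ) - 1) = _
  simp only [expXiCoeff, mul_assoc]
  rw [fourierCoeff.const_mul, fourierCoeff_fourier_mul]
  rfl

section Truncated

variable {n : ℕ} [NeZero n] (w : Fin n → H n) (N : ℕ)

theorem omegaCoeff_add (m : ℕ) (l : ℤ) : omegaCoeff w (m + n) (l + n) = omegaCoeff w m l := by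
  have h : omega w (m + n) = fun θ => fourier (n : ℤ) θ * omega w m θ := by
    funext θ
    have h1 : Fin.ofNat n (m + n) = Fin.ofNat n m := by
      ext
      simp
    rw [omega, omega, h1, Nat.add_div_right _ (NeZero.pos n), ← mul_assoc, ← fourier_add]
    congr 3
    push_cast
    ring
  rw [omegaCoeff, h, fourierCoeff_fourier_mul, add_sub_cancel_right]
  rfl

theorem tauN_eq : tauN w N = tauDet (omegaCoeff w) (n * N) := by
  rw [tauN, tauDet]
  congr 1
  ext1 i j
  rw [Matrix.of_apply, Matrix.of_apply, moment_eq_expCoeff]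
  congr 1
  push_cast
  ring

theorem fN_eq (s : Fin (n * N)) :
    fN w N s = expCoeff (omegaCoeff w s) ((n * N : ℕ) - 1) := moment_eq_expCoeff _ _

theorem D_iterate_fN (s : Fin (n * N)) (j : Fin (n * N + 1)) :
    D^[n * N - j] (fN w N s) = wronskianRows (omegaCoeff w) (n * N) s j := by
  have := j.isLt
  rw [fN_eq, D_iterate_expCoeff, wronskianRows]
  congr 1
  omega

/-- Each `D` lowers the power of `z` by one, so with `M = nN` the entry `D ^ (M-1-j) f_s` is the
coefficient of `z ^ j` in `exp ξ ω_{s+1}`: the two matrices are transposes. -/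
theorem wronskian_fN : wronskian (fN w N) = tauDet (omegaCoeff w) (n * N) := by
  rw [wronskian, tauDet, ← Matrix.det_transpose]
  congr 1
  ext1 i j
  rw [Matrix.transpose_apply, Matrix.of_apply, Matrix.of_apply, fN_eq, D_iterate_expCoeff]
  congr 1
  have := i.isLt
  omega

theorem coeff_DeltaN (k : ℤ) :
    (DeltaN w N).coeff k = (∑ j : Fin (n * N + 1), (if k = (n * N : ℕ) - (j : ℤ) then 1 else 0) *
      topCofactor (wronskianRows (omegaCoeff w) (n * N)) j) *
        (tauDet (omegaCoeff w) (n * N))⁻¹ := by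
  rw [← det_cons_eq_sum, ← wronskian_fN]
  simp only [DeltaN, D_iterate_fN]

/-- The `τ`-function formula holds before any limit. It reduces both the convergence of `S_{W,N}`
and its independence of the frame to statements about `τ_{W,N}`. -/
theorem coeff_SN (k : ℤ) : (SN w N).coeff k = (waveOfTau (tauN w N)).coeff k := by
  rw [SN, PDO.coeff_mul_Dpow, coeff_DeltaN, tauN_eq]
  change _ = if k ≤ 0 then miwa (tauDet (omegaCoeff w) (n * N)) (-k).toNat *
    (tauDet (omegaCoeff w) (n * N))⁻¹ else 0
  split_ifs with hk
  · rw [miwa_tauDet]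
    congr 1
    refine Finset.sum_congr rfl fun j _ => ?_
    congr 2
    exact propext ⟨fun h => by omega, fun h => by omega⟩
  · rw [Finset.sum_eq_zero, zero_mul]
    intro j _
    rw [if_neg (by omega), zero_mul]

theorem SN_eq_of_tauN_eq {w w' : Fin n → H n} {N : ℕ} (h : tauN w N = tauN w' N) :
    SN w N = SN w' N := by
  ext1
  funext k
  rw [coeff_SN, coeff_SN, h]

theorem SN_mul_Dpow : SN w N * PDO.Dpow (n * N : ℕ) = DeltaN w N := by
  rw [SN, mul_assoc, PDO.Dpow_mul_Dpow, neg_add_cancel, PDO.Dpow_zero, mul_one]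

variable {w} in
theorem isMonic_SN (hw : IsUnitriangular (omegaCoeff w)) : (SN w N).IsMonic 0 := by
  constructor
  · rw [coeff_SN]
    change (if (0 : ℤ) ≤ 0 then miwa (tauN w N) (-0 : ℤ).toNat * (tauN w N)⁻¹ else 0) = 1
    rw [if_pos le_rfl, neg_zero, Int.toNat_zero, miwa_zero, tauN_eq]
    exact MvPowerSeries.mul_inv_cancel _ (by rw [constantCoeff_tauDet hw]; exact one_ne_zero)
  · intro k hk
    rw [coeff_SN]
    exact if_neg (by omega)

theorem isDiff_DeltaN : (DeltaN w N).IsDiff := by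
  intro k hk
  rw [coeff_DeltaN, Finset.sum_eq_zero, zero_mul]
  intro j _
  have := j.isLt
  rw [if_neg (by omega), zero_mul]

variable {w} in
theorem isMonic_DeltaN (hw : IsUnitriangular (omegaCoeff w)) :
    (DeltaN w N).IsMonic (n * N : ℕ) := by
  have := (isMonic_SN N hw).mul (PDO.isMonic_Dpow (n * N : ℕ))
  rwa [SN_mul_Dpow, zero_add] at this

theorem coeff_DeltaN_sub (j : Fin (n * N + 1)) :
    (DeltaN w N).coeff ((n * N - j : ℕ) : ℤ) =
      topCofactor (wronskianRows (omegaCoeff w) (n * N)) j *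
        (tauDet (omegaCoeff w) (n * N))⁻¹ := by
  have hj := j.isLt
  rw [coeff_DeltaN, Finset.sum_eq_single_of_mem j (Finset.mem_univ _), if_pos (by omega), one_mul]
  intro i _ hi
  have hi' := i.isLt
  rw [if_neg, zero_mul]
  intro h
  exact hi (Fin.ext (by omega))

variable {w} in
-- The numerator becomes a determinant with a repeated row.
theorem app_DeltaN_fN (hw : IsUnitriangular (omegaCoeff w)) (s : Fin (n * N)) :
    PDO.app (DeltaN w N) (fN w N s) = 0 := by
  have hle : SeqLE (DeltaN w N).coeff ((n * N + 1 : ℕ) - 1) :=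
    SeqLE.mono (isMonic_DeltaN N hw).2 (by push_cast; omega)
  have h0 : (Matrix.of (Fin.cons (wronskianRows (omegaCoeff w) (n * N) s)
      (wronskianRows (omegaCoeff w) (n * N)) : Fin (n * N + 1) → Fin (n * N + 1) → R)).det = 0 :=
    Matrix.det_zero_of_row_eq (Fin.succ_ne_zero s).symm rfl
  rw [PDO.app_eq_sum hle, ← Finset.sum_range_reflect, Finset.sum_range]
  simp only [Nat.add_sub_cancel]
  rw [← zero_mul (tauDet (omegaCoeff w) (n * N))⁻¹, ← h0, det_cons_eq_sum, Finset.sum_mul]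
  refine Finset.sum_congr rfl fun j _ => ?_
  rw [coeff_DeltaN_sub, D_iterate_fN]
  ring

theorem wronskian_fN_ne_zero {w : Fin n → H n} (hw : IsUnitriangular (omegaCoeff w)) (N : ℕ) :
    wronskian (fN w N) ≠ 0 := by
  rw [wronskian_fN]
  exact tauDet_ne_zero hw _

/-- The evolution of the truncated dressing operator. -/
theorem exists_tderiv_SN {w : Fin n → H n} (hw : IsUnitriangular (omegaCoeff w)) (N : ℕ)
    (j : ℕ+) : ∃ B : PDO, B.IsDiff ∧
      (SN w N).tderiv j + SN w N * PDO.Dpow (j : ℕ) = B * SN w N := by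
  have hd := isDiff_DeltaN w N
  -- Since `D ^ j f_s = ∂f_s/∂t_j`, the operator `P` sends `f_s` to `∂(Δ f_s)/∂t_j = 0`.
  obtain ⟨B, hB, h⟩ := PDO.exists_eq_mul_of_app_eq_zero hd (isMonic_DeltaN N hw)
    (wronskian_fN_ne_zero hw N) (app_DeltaN_fN N hw)
    (P := (DeltaN w N).tderiv j + DeltaN w N * PDO.Dpow (j : ℕ))
    ((hd.tderiv j).add (hd.mul (PDO.isDiff_Dpow _))) (fun s => by
      rw [PDO.app_add, PDO.app_mul hd (PDO.isDiff_Dpow _), PDO.app_Dpow, fN_eq,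
        D_iterate_expCoeff, ← pd_expCoeff, ← PDO.pd_app, ← fN_eq, app_DeltaN_fN N hw]
      exact map_zero _)
  refine ⟨B, hB, ?_⟩
  have h1 := congrArg (· * PDO.Dpow (-(n * N : ℕ))) h
  simp only [add_mul, mul_assoc] at h1
  rw [PDO.Dpow_mul_Dpow, add_comm ((j : ℕ) : ℤ), ← PDO.Dpow_mul_Dpow,
    ← mul_assoc (DeltaN w N)] at h1
  rw [show B * SN w N = B * (DeltaN w N * PDO.Dpow (-(n * N : ℕ))) from rfl, ← h1, SN,
    PDO.tderiv_mul, PDO.tderiv_Dpow, mul_zero, add_zero]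

/-- Invariance of the space under multiplication by `z ^ n`, in terms of dressing operators. -/
theorem exists_SN_succ {w : Fin n → H n} (hw : IsUnitriangular (omegaCoeff w)) (N : ℕ) :
    ∃ B : PDO, B.IsDiff ∧ SN w (N + 1) * PDO.Dpow n = B * SN w N := by
  -- Multiplication by `z ^ n` raises the index of `ω` by `n` and compensates the change from `z ^
  -- (-nN)` to `z ^ (-n(N+1))`. Hence `Δ_{W,N+1}` annihilates every `f_{s,N}`.
  have hf : ∀ s : Fin (n * N), fN w N s = fN w (N + 1) ⟨s + n, by rw [mul_add]; omega⟩ := by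
    intro s
    rw [fN_eq, fN_eq]
    ext d
    rw [coeff_expCoeff, coeff_expCoeff, ← omegaCoeff_add]
    congr 2
    push_cast
    ring
  obtain ⟨B, hB, h⟩ := PDO.exists_eq_mul_of_app_eq_zero (isDiff_DeltaN w N) (isMonic_DeltaN N hw)
    (wronskian_fN_ne_zero hw N) (app_DeltaN_fN N hw) (isDiff_DeltaN w (N + 1))
    (fun s => by rw [hf, app_DeltaN_fN _ hw])
  refine ⟨B, hB, ?_⟩
  rw [SN, SN, ← mul_assoc, ← h, mul_assoc, PDO.Dpow_mul_Dpow]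
  congr 2
  push_cast
  ring

end Truncated

/-! ### The hierarchies from the dressing operator -/

namespace PDO

theorem IsMonic.conj_pow_mul {S : PDO} (hS : S.IsMonic 0) (k : ℕ) :
    (S * Dpow 1 * S⁻¹) ^ k * S = S * Dpow k := by
  induction k with
  | zero => rw [pow_zero, one_mul, Nat.cast_zero, Dpow_zero, mul_one]
  | succ k ih =>
    rw [pow_succ, mul_assoc, mul_assoc (S * Dpow 1), hS.inv_mul, mul_one, ← mul_assoc, ih,
      mul_assoc, Dpow_mul_Dpow, Nat.cast_succ]

theorem IsMonic.conj_pow {S : PDO} (hS : S.IsMonic 0) (k : ℕ) :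
    (S * Dpow 1 * S⁻¹) ^ k = S * Dpow k * S⁻¹ := by
  rw [← hS.conj_pow_mul, mul_assoc _ S, hS.mul_inv, mul_one]

theorem IsMonic.conj {S : PDO} (hS : S.IsMonic 0) (k : ℤ) : (S * Dpow k * S⁻¹).IsMonic k := by
  have := (hS.mul (isMonic_Dpow k)).mul hS.inv
  rwa [zero_add, add_zero] at this

/-- Compare coefficients of `D ^ (k-1)`: the subleading coefficient of `S` occurs on both sides, and
its leading coefficient `1` has zero derivative. -/
theorem coeff_eq_zero_of_mul_eq {L S : PDO} {k : ℤ} (hS : S.IsMonic 0) (hL : L.IsMonic k)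
    (h : L * S = S * Dpow k) : L.coeff (k - 1) = 0 := by
  have h1 := coeff_mul_subtop hL.2 hS.2
  rw [h, coeff_mul_Dpow, hS.1, hL.1, show D (1 : R) = 0 from MvPowerSeries.pderiv_one, smul_zero,
    add_zero, add_zero, mul_one, one_mul, show k - 1 - k = 0 - 1 by ring] at h1
  exact right_eq_add.1 h1

/-- The Sato equation `∂S/∂t_j = (S D ^ j S⁻¹)₊ S - S D ^ j`. -/
theorem IsMonic.sato {S : PDO} (hS : S.IsMonic 0) (j : ℕ+)
    (h : ((S.tderiv j + S * Dpow (j : ℕ)) * S⁻¹).IsDiff) :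
    S.tderiv j + S * Dpow (j : ℕ) = ((S * Dpow 1 * S⁻¹) ^ (j : ℕ)).plus * S := by
  have h1 : ((S * Dpow 1 * S⁻¹) ^ (j : ℕ)).plus = (S.tderiv j + S * Dpow (j : ℕ)) * S⁻¹ := by
    -- `S D ^ j S⁻¹` differs from the given differential operator by `(∂S/∂t_j) S⁻¹`, which has
    -- negative order because the leading coefficient of `S` is constant.
    refine plus_eq_of_sub_le h ?_
    rw [hS.conj_pow, add_mul, sub_add_cancel_right]
    have := mul_le (hS.tderiv_le j) hS.inv.2
    exact fun k hk => by rw [coeff_neg, this k (by omega), neg_zero]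
  rw [h1, mul_assoc, hS.inv_mul, mul_one]

/-- Differentiate `𝓛 S = S D`, substitute the Sato equation for `∂S/∂t_j`, and cancel `S` on the
right. -/
theorem IsMonic.lax {S : PDO} (hS : S.IsMonic 0) (j : ℕ+)
    (h : ((S.tderiv j + S * Dpow (j : ℕ)) * S⁻¹).IsDiff) :
    (S * Dpow 1 * S⁻¹).tderiv j =
      comm ((S * Dpow 1 * S⁻¹) ^ (j : ℕ)).plus (S * Dpow 1 * S⁻¹) := by
  have hsato := hS.sato j h
  have h1 := hS.conj_pow_mul 1
  rw [pow_one, Nat.cast_one] at h1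
  set L := S * Dpow 1 * S⁻¹
  set B := (L ^ (j : ℕ)).plus
  have h2 : S.tderiv j = B * S - S * Dpow (j : ℕ) := eq_sub_of_add_eq hsato
  have h3 : L.tderiv j * S + L * S.tderiv j = S.tderiv j * Dpow 1 := by
    rw [← tderiv_mul, h1, tderiv_mul, tderiv_Dpow, mul_zero, add_zero]
  have h4 : L * (S * Dpow (j : ℕ)) = S * Dpow (j : ℕ) * Dpow 1 := by
    rw [← mul_assoc, h1, mul_assoc, mul_assoc, Dpow_mul_Dpow, Dpow_mul_Dpow, add_comm]
  have h5 : L.tderiv j * S = comm B L * S := by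
    rw [eq_sub_of_add_eq h3, h2, sub_mul, mul_sub, h4, comm, sub_mul, mul_assoc B S, ← h1,
      mul_assoc B L, mul_assoc L B]
    abel
  have h6 := congrArg (· * S⁻¹) h5
  simpa only [mul_assoc, hS.mul_inv, mul_one] using h6

theorem isKPSolution {S : PDO} (hS : S.IsMonic 0)
    (h : ∀ j : ℕ+, ((S.tderiv j + S * Dpow (j : ℕ)) * S⁻¹).IsDiff) :
    IsKPSolution (S * Dpow 1 * S⁻¹) where
  monic := hS.conj 1
  sub := by
    have h1 := hS.conj_pow_mul 1
    rw [pow_one, Nat.cast_one] at h1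
    exact coeff_eq_zero_of_mul_eq hS (hS.conj 1) h1
  lax j := hS.lax j (h j)

theorem isGelfandDickeySolution {S : PDO} (hS : S.IsMonic 0)
    (h : ∀ j : ℕ+, ((S.tderiv j + S * Dpow (j : ℕ)) * S⁻¹).IsDiff) {n : ℕ}
    (hn : (S * Dpow n * S⁻¹).IsDiff) :
    IsGelfandDickeySolution n ((S * Dpow 1 * S⁻¹) ^ n) (S * Dpow 1 * S⁻¹) := by
  have hm : ((S * Dpow 1 * S⁻¹) ^ n).IsMonic n := by
    rw [hS.conj_pow]
    exact hS.conj n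
  have hd : ((S * Dpow 1 * S⁻¹) ^ n).IsDiff := by rwa [hS.conj_pow]
  have hl : ∀ j : ℕ+, ((S * Dpow 1 * S⁻¹) ^ n).tderiv j =
      comm ((S * Dpow 1 * S⁻¹) ^ (j : ℕ)).plus ((S * Dpow 1 * S⁻¹) ^ n) :=
    fun j => tderiv_pow_eq_comm (hS.lax j (h j)) n
  refine ⟨hm, coeff_eq_zero_of_mul_eq hS hm (hS.conj_pow_mul n), hd.plus_eq.symm, hS.conj 1, rfl,
    hl, ?_⟩
  rintro j ⟨q, hq⟩ k
  -- For `j = nq` the power `𝓛 ^ j = L ^ q` is already differential, so the Lax equation is a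
  -- commutator of `L ^ q` with `L`.
  have h1 : ((S * Dpow 1 * S⁻¹) ^ n).tderiv j = 0 := by
    rw [hl, hq, pow_mul, (hd.pow q).plus_eq, comm, ← pow_succ, ← pow_succ', sub_self]
  exact congrFun (congrArg PDO.coeff h1) k

/-- A wave `S exp ξ` has the same coefficients as `S`. Operators act by left multiplication and `z ^
k` by right multiplication with `D ^ k`, so the claims are `L S = S D ^ n` and the Sato equation. -/
theorem isWaveFunction {S : PDO} (hS : S.IsMonic 0)
    (h : ∀ j : ℕ+, ((S.tderiv j + S * Dpow (j : ℕ)) * S⁻¹).IsDiff) (n : ℕ) :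
    IsWaveFunction n ((S * Dpow 1 * S⁻¹) ^ n) (S * Dpow 1 * S⁻¹) ⟨S.coeff, S.bdd⟩ where
  leading := hS.1
  pos := hS.2
  eigen := by
    ext1
    funext k
    change ((S * Dpow 1 * S⁻¹) ^ n * S).coeff k = S.coeff (k - n)
    rw [hS.conj_pow_mul, coeff_mul_Dpow]
  evolution j := by
    ext1
    funext k
    change pd j (S.coeff k) + S.coeff (k - (j : ℕ)) =
      (((S * Dpow 1 * S⁻¹) ^ (j : ℕ)).plus * S).coeff k
    rw [← hS.sato j (h j), coeff_add, coeff_mul_Dpow, coeff_tderiv]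

end PDO

theorem act_expXi (S : PDO) : Wave.act S Wave.expXi = ⟨S.coeff, S.bdd⟩ := by
  ext1
  change (S * 1).coeff = S.coeff
  rw [mul_one]

/-! ### The limit -/

/-- The limit of the truncated dressing operators. -/
def dressing (τ : R) : PDO := ⟨(waveOfTau τ).coeff, (waveOfTau τ).bdd⟩

section Limit

variable {n : ℕ} [NeZero n] {w : Fin n → H n}

theorem tendsto_mul_atTop : Filter.Tendsto (fun N => n * N) Filter.atTop Filter.atTop :=
  Filter.tendsto_id.const_mul_atTop' (NeZero.pos n)

theorem isStableLimit_tauN (hw : IsUnitriangular (omegaCoeff w)) :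
    IsStableLimit (tauN w) (tauLimit (omegaCoeff w)) := by
  simp only [funext (tauN_eq w)]
  exact (isStableLimit_tauDet hw).comp_tendsto tendsto_mul_atTop

theorem isStableLimit_SN (hw : IsUnitriangular (omegaCoeff w)) :
    PDO.IsStableLimit (SN w) (dressing (tauLimit (omegaCoeff w))) := by
  intro k
  simp only [coeff_SN]
  change IsStableLimit (fun N => if k ≤ 0 then miwa (tauN w N) (-k).toNat * (tauN w N)⁻¹ else 0)
    (if k ≤ 0 then miwa (tauLimit (omegaCoeff w)) (-k).toNat * (tauLimit (omegaCoeff w))⁻¹ else 0)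
  have h := isStableLimit_tauN hw
  split_ifs
  · refine (h.miwa _).mul (h.inv (fun N => ?_) ?_)
    · rw [tauN_eq, constantCoeff_tauDet hw]; exact one_ne_zero
    · rw [constantCoeff_tauLimit]; exact one_ne_zero
  · exact IsStableLimit.const 0

theorem isMonic_dressing (hw : IsUnitriangular (omegaCoeff w)) :
    (dressing (tauLimit (omegaCoeff w))).IsMonic 0 :=
  (isStableLimit_SN hw).isMonic fun N => isMonic_SN N hw

theorem isStableLimit_LaxN (hw : IsUnitriangular (omegaCoeff w)) :
    PDO.IsStableLimit (LaxN w) (dressing (tauLimit (omegaCoeff w)) * PDO.Dpow 1 *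
      (dressing (tauLimit (omegaCoeff w)))⁻¹) :=
  have h := isStableLimit_SN hw
  have hm := fun N => isMonic_SN N hw
  (h.mul (fun N => (hm N).2) (.const _) fun _ => PDO.Dpow_le 1).mul
    (fun N => ((hm N).mul (PDO.isMonic_Dpow 1)).2) (h.inv hm) fun N => (hm N).inv.2

/-- The limit of the differential operators `B` of `exists_tderiv_SN`; vanishing of the negative
coefficients passes to stable limits. -/
theorem isDiff_evolution (hw : IsUnitriangular (omegaCoeff w)) (j : ℕ+) :
    (((dressing (tauLimit (omegaCoeff w))).tderiv j + dressing (tauLimit (omegaCoeff w)) *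
      PDO.Dpow (j : ℕ)) * (dressing (tauLimit (omegaCoeff w)))⁻¹).IsDiff := by
  have h := isStableLimit_SN hw
  have hm := fun N => isMonic_SN N hw
  have h1 := ((h.tderiv j).add (h.mul (fun N => (hm N).2) (.const _)
    fun _ => PDO.Dpow_le (j : ℕ))).mul (K := (j : ℕ)) (fun N => ?_) (h.inv hm)
      fun N => (hm N).inv.2
  · refine h1.isDiff fun N => ?_
    obtain ⟨B, hB, e⟩ := exists_tderiv_SN hw N j
    rwa [e, mul_assoc, (hm N).mul_inv, mul_one]
  · refine SeqLE.add (a := ((SN w N).tderiv j).coeff)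
      (b := (SN w N * PDO.Dpow (j : ℕ)).coeff) ?_ ?_
    · exact ((hm N).tderiv_le j).mono (by omega)
    · exact (PDO.mul_le (hm N).2 (PDO.Dpow_le _)).mono (by omega)

/-- `S_{W,N+1}` and `S_{W,N}` have the same limit, so `S D ^ n S⁻¹` is the limit of the differential
operators `S_{W,N+1} D ^ n S_{W,N}⁻¹`. -/
theorem isDiff_conj_Dpow (hw : IsUnitriangular (omegaCoeff w)) :
    (dressing (tauLimit (omegaCoeff w)) * PDO.Dpow n *
      (dressing (tauLimit (omegaCoeff w)))⁻¹).IsDiff := by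
  have h := isStableLimit_SN hw
  have hm := fun N => isMonic_SN N hw
  have h1 := ((h.comp_tendsto (Filter.tendsto_add_atTop_nat 1)).mul (fun N => (hm _).2) (.const _)
    fun _ => PDO.Dpow_le n).mul (fun N => ((hm _).mul (PDO.isMonic_Dpow n)).2) (h.inv hm)
      fun N => (hm N).inv.2
  refine h1.isDiff fun N => ?_
  obtain ⟨B, hB, e⟩ := exists_SN_succ hw N
  rwa [e, mul_assoc, (hm N).mul_inv, mul_one]

end Limit

/-! ### Fourier coefficients -/

section FourierCoefficients

variable {n : ℕ}

theorem integrable_H (f : H n) : Integrable (f : UnitAddCircle → _) haarAddCircle :=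
  (Lp.memLp f).integrable one_le_two

theorem integrable_H_apply (f : H n) (i : Fin n) :
    Integrable (fun θ => f θ i) haarAddCircle :=
  (EuclideanSpace.proj i : EuclideanSpace ℂ (Fin n) →L[ℂ] ℂ).integrable_comp (integrable_H f)

theorem fourierCoeff_apply (f : H n) (k : ℤ) (i : Fin n) :
    fourierCoeff (f : UnitAddCircle → _) k i = fourierCoeff (fun θ => f θ i) k := by
  have h := ContinuousLinearMap.integral_comp_comm
    (EuclideanSpace.proj i : EuclideanSpace ℂ (Fin n) →L[ℂ] ℂ) ((integrable_H f).fourier_smul (-k))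
  exact h.symm

theorem inner_e (f : H n) (α : Fin n) (k : ℤ) :
    inner ℂ (e n α k) f = fourierCoeff (f : UnitAddCircle → _) k α := by
  rw [fourierCoeff_apply, L2.inner_def, fourierCoeff]
  refine integral_congr_ae ?_
  filter_upwards [ContinuousMap.coeFn_toLp (p := 2) (𝕜 := ℂ) haarAddCircle
    (⟨fun θ : UnitAddCircle => fourier k θ • EuclideanSpace.single α (1 : ℂ), by fun_prop⟩ :
      C(UnitAddCircle, EuclideanSpace ℂ (Fin n)))] with θ hθ
  rw [e, hθ]
  simp only [ContinuousMap.coe_mk, inner_smul_left, EuclideanSpace.inner_single_left, map_one,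
    one_mul, smul_eq_mul, fourier_neg]

theorem fourierCoeff_e (α β : Fin n) (k l : ℤ) :
    fourierCoeff (e n α k : UnitAddCircle → _) l β = if α = β ∧ k = l then 1 else 0 := by
  have h1 : (fun θ => (e n α k : UnitAddCircle → _) θ β) =ᵐ[haarAddCircle]
      fun θ => (if α = β then 1 else 0) * fourier k θ := by
    filter_upwards [ContinuousMap.coeFn_toLp (p := 2) (𝕜 := ℂ) haarAddCircle
      (⟨fun θ : UnitAddCircle => fourier k θ • EuclideanSpace.single α (1 : ℂ), by fun_prop⟩ :
        C(UnitAddCircle, EuclideanSpace ℂ (Fin n)))] with θ hθ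
    rw [e, hθ]
    simp [eq_comm, -fourier_apply]
  rw [fourierCoeff_apply, fourierCoeff_congr_ae h1, fourierCoeff.const_mul, fourierCoeff_fourier,
    Pi.single_apply]
  by_cases h : α = β <;> by_cases h' : k = l <;> simp [h, h', eq_comm]

theorem measurePreserving_nsmul_circle [NeZero n] :
    MeasurePreserving (fun θ : UnitAddCircle => n • θ) haarAddCircle haarAddCircle := by
  have := Measure.measurePreserving_zsmul (haarAddCircle : Measure UnitAddCircle)
    (n := (n : ℤ)) (by exact_mod_cast NeZero.ne n)
  simpa only [natCast_zsmul] using this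

theorem integral_comp_nsmul [NeZero n] {h : UnitAddCircle → ℂ}
    (hh : AEStronglyMeasurable h haarAddCircle) :
    ∫ θ, h (n • θ) ∂haarAddCircle = ∫ θ, h θ ∂haarAddCircle := by
  have hmp := measurePreserving_nsmul_circle (n := n)
  have h1 := integral_map (f := h) hmp.measurable.aemeasurable (by rwa [hmp.map_eq])
  rw [hmp.map_eq] at h1
  exact h1.symm

theorem fourier_nsmul_apply (k : ℤ) (θ : UnitAddCircle) :
    fourier k (n • θ) = fourier (n * k) θ := by
  simp only [fourier_apply, mul_comm (n : ℤ) k, mul_smul, natCast_zsmul]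

theorem fourier_apply_add (k : ℤ) (θ u : UnitAddCircle) :
    fourier k (θ + u) = fourier k u * fourier k θ := by
  simp only [fourier_apply, smul_add, toCircle_add, Circle.coe_mul, mul_comm]

/-- If `n ∣ l`, the map `θ ↦ nθ` preserves Haar measure. Otherwise translation by `1/n` fixes
`g(nθ)` and multiplies the character by a root of unity other than `1`, so the integral vanishes. -/
theorem fourierCoeff_comp_nsmul [NeZero n] {g : UnitAddCircle → ℂ}
    (hg : Integrable g haarAddCircle) (l : ℤ) :
    fourierCoeff (fun θ => g (n • θ)) l = if (n : ℤ) ∣ l then fourierCoeff g (l / n) else 0 := by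
  have hn : (n : ℤ) ≠ 0 := by exact_mod_cast NeZero.ne n
  split_ifs with h
  · obtain ⟨q, rfl⟩ := h
    rw [Int.mul_ediv_cancel_left _ hn]
    have h1 := integral_comp_nsmul (n := n) (hg.fourier_smul (-q)).aestronglyMeasurable
    simp only [fourier_nsmul_apply, mul_neg] at h1
    exact h1
  · set u : UnitAddCircle := ((1 / n : ℝ) : UnitAddCircle)
    have hu : addOrderOf u = n := addOrderOf_period_div (p := (1 : ℝ)) (NeZero.pos n)
    have hnu : n • u = 0 := by
      have := addOrderOf_nsmul_eq_zero u
      rwa [hu] at this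
    have hζ : fourier (-l) u ≠ 1 := by
      intro h1
      rw [fourier_apply] at h1
      have h2 : toCircle (-l • u) = 1 := Subtype.ext h1
      rw [← toCircle_zero (T := (1 : ℝ))] at h2
      have h3 := injective_toCircle one_ne_zero h2
      rw [← addOrderOf_dvd_iff_zsmul_eq_zero, hu, dvd_neg] at h3
      exact h h3
    have h1 := integral_add_right_eq_self (μ := (haarAddCircle : Measure UnitAddCircle))
      (fun θ => fourier (-l) θ • g (n • θ)) u
    have h2 : (fun θ => fourier (-l) (θ + u) • g (n • (θ + u))) =
        fun θ => fourier (-l) u * (fourier (-l) θ • g (n • θ)) := by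
      funext θ
      rw [nsmul_add, hnu, add_zero, fourier_apply_add, smul_eq_mul, smul_eq_mul, mul_assoc]
    rw [h2, integral_const_mul] at h1
    have h3 : (fourier (-l) u - 1) * fourierCoeff (fun θ => g (n • θ)) l = 0 := by
      rw [sub_mul, one_mul, sub_eq_zero]
      exact h1
    exact (mul_eq_zero.1 h3).resolve_left (sub_ne_zero.2 hζ)

/-- The component `l mod n` of the index set of the Fourier coefficients of `Ξ f`. -/
def residue (n : ℕ) [NeZero n] (l : ℤ) : Fin n :=
  ⟨(l % n).toNat, by
    have h : (0 : ℤ) < n := by exact_mod_cast NeZero.pos n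
    have := Int.emod_lt_of_pos l h
    omega⟩

theorem fourierCoeff_Xi_eq_sum [NeZero n] (f : H n) (l : ℤ) :
    fourierCoeff (Xi f) l = ∑ i : Fin n, if (n : ℤ) ∣ l - i then
      fourierCoeff (f : UnitAddCircle → _) ((l - i) / n) i else 0 := by
  have hint : ∀ i : Fin n, Integrable (fun θ : UnitAddCircle => f (n • θ) i) haarAddCircle :=
    fun i => (measurePreserving_nsmul_circle (n := n)).integrable_comp_of_integrable
      (g := fun θ => f θ i) (integrable_H_apply f i)
  have h1 : Xi f = ∑ i : Fin n, fun θ => fourier (i : ℤ) θ * f (n • θ) i := by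
    funext θ
    rw [Finset.sum_apply]
    rfl
  have h2 := fourierCoeff.sum Finset.univ
    (fun (i : Fin n) (θ : UnitAddCircle) => fourier (i : ℤ) θ * f (n • θ) i)
    fun i _ => (hint i).fourier_smul (i : ℤ)
  rw [h1, h2, Finset.sum_apply]
  refine Finset.sum_congr rfl fun i _ => ?_
  rw [fourierCoeff_apply]
  exact (fourierCoeff_fourier_mul (i : ℤ) l fun θ => f (n • θ) i).trans
    (fourierCoeff_comp_nsmul (g := fun θ => f θ i) (integrable_H_apply f i) (l - i))

theorem fourierCoeff_Xi [NeZero n] (f : H n) (l : ℤ) :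
    fourierCoeff (Xi f) l = fourierCoeff (f : UnitAddCircle → _) (l / n) (residue n l) := by
  have hn : (0 : ℤ) < n := by exact_mod_cast NeZero.pos n
  have hr : ((residue n l : ℕ) : ℤ) = l % n := Int.toNat_of_nonneg (Int.emod_nonneg l hn.ne')
  rw [fourierCoeff_Xi_eq_sum, Finset.sum_eq_single_of_mem (residue n l) (Finset.mem_univ _)]
  · have h2 : l - ((residue n l : ℕ) : ℤ) = n * (l / n) := by
      have := Int.emod_add_mul_ediv l n
      omega
    rw [h2, if_pos (dvd_mul_right _ _), Int.mul_ediv_cancel_left _ hn.ne']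
  · intro i _ hi
    rw [if_neg]
    intro h
    refine hi (Fin.ext ?_)
    have h4 : l % n = (i : ℤ) % n := (Int.emod_eq_emod_iff_emod_sub_eq_zero).2
      (Int.emod_eq_zero_of_dvd h)
    rw [Int.emod_eq_of_lt (a := (i : ℕ)) (by omega) (by exact_mod_cast i.isLt)] at h4
    omega

theorem omegaCoeff_eq [NeZero n] (w : Fin n → H n) (m : ℕ) (l : ℤ) :
    omegaCoeff w m l = fourierCoeff (w (Fin.ofNat n m) : UnitAddCircle → _)
      ((l - (n * (m / n) : ℕ)) / n) (residue n (l - (n * (m / n) : ℕ))) := by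
  rw [← fourierCoeff_Xi, ← fourierCoeff_fourier_mul]
  rfl

end FourierCoefficients

/-! ### Normalized frames -/

section Frames

variable {n : ℕ} {W : Submodule ℂ (H n)}

theorem e_mem_Hplus (α : Fin n) {k : ℤ} (hk : 0 ≤ k) : e n α k ∈ Hplus n :=
  Submodule.le_topologicalClosure _ (Submodule.subset_span ⟨α, k, hk, rfl⟩)

theorem prPlus_eq_zero {f : W}
    (h : ∀ (α : Fin n) (k : ℤ), 0 ≤ k → fourierCoeff ((f : H n) : UnitAddCircle → _) k α = 0) :
    prPlus W f = 0 := by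
  change (Hplus n).orthogonalProjectionOnto (f : H n) = 0
  rw [Submodule.orthogonalProjectionOnto_eq_zero_iff, Hplus, Submodule.orthogonal_closure,
    Submodule.mem_orthogonal]
  intro u hu
  induction hu using Submodule.span_induction with
  | mem x hx =>
    obtain ⟨α, k, hk, rfl⟩ := hx
    rw [inner_e, h α k hk]
  | zero => exact inner_zero_left _
  | add x y _ _ hx hy => rw [inner_add_left, hx, hy, add_zero]
  | smul a x _ hx => rw [inner_smul_left, hx, mul_zero]

theorem eq_zero_of_fourierCoeff (hcell : InBigCell W) {f : H n} (hf : f ∈ W)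
    (h : ∀ (α : Fin n) (k : ℤ), 0 ≤ k → fourierCoeff (f : UnitAddCircle → _) k α = 0) :
    f = 0 := by
  have h1 : prPlus W ⟨f, hf⟩ = 0 := prPlus_eq_zero h
  have h2 : (⟨f, hf⟩ : W) = 0 := hcell.1 (h1.trans (map_zero _).symm)
  exact congrArg Subtype.val h2

theorem exists_mem_fourierCoeff (hcell : InBigCell W) (j : Fin n) :
    ∃ f ∈ W, ∀ (α : Fin n) (k : ℤ), 0 ≤ k →
      fourierCoeff (f : UnitAddCircle → _) k α = if j = α ∧ 0 = k then 1 else 0 := by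
  obtain ⟨f, hf⟩ := hcell.2 ⟨e n j 0, e_mem_Hplus j le_rfl⟩
  refine ⟨f, f.2, fun α k hk => ?_⟩
  have h1 := Submodule.inner_orthogonalProjectionOnto_eq_of_mem_left
    (K := Hplus n) ⟨e n α k, e_mem_Hplus α hk⟩ (f : H n)
  have h2 : (Hplus n).orthogonalProjectionOnto (f : H n) = ⟨e n j 0, e_mem_Hplus j le_rfl⟩ := hf
  rw [← inner_e, ← fourierCoeff_e, ← inner_e, ← h1, h2]
  rfl

/-- The frame whose matrix is `1` plus a series in strictly negative powers of `z`. -/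
theorem exists_isNormalizedFrame (hcell : InBigCell W) :
    ∃ w : Fin n → H n, IsNormalizedFrame W w ∧ ∀ j α, ∀ k : ℤ, 0 ≤ k →
      fourierCoeff (w j : UnitAddCircle → _) k α = if j = α ∧ 0 = k then 1 else 0 := by
  choose w hw h using exists_mem_fourierCoeff hcell
  refine ⟨w, ⟨hw, fun j i k hk => ?_, fun j => ?_, fun j i hij => ?_⟩, h⟩
  · rw [h j i k hk.le, if_neg (by omega)]
  · rw [h j j 0 le_rfl, if_pos ⟨rfl, rfl⟩]
  · rw [h j i 0 le_rfl, if_neg (fun h => hij.ne h.1)]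

/-- `Ξ` places the coefficient of `z ^ k` in component `i` (counted from `0`) at `z ^ (nk + i)`. The
absence of positive powers and the unipotent constant part together say that `Ξ(w_j)` starts with `z
^ j`, with coefficient `1`. -/
theorem IsNormalizedFrame.isUnitriangular [NeZero n] {w : Fin n → H n}
    (hw : IsNormalizedFrame W w) : IsUnitriangular (omegaCoeff w) := by
  have hn : (0 : ℤ) < n := by exact_mod_cast NeZero.pos n
  have hm : ∀ m : ℕ, (m : ℤ) = (n * (m / n) : ℕ) + (Fin.ofNat n m : ℕ) := fun m => by
    rw [Fin.val_ofNat]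
    exact_mod_cast (Nat.div_add_mod m n).symm
  constructor
  · intro m l hl
    rw [omegaCoeff_eq]
    have h1 := hm m
    generalize hx : l - (n * (m / n) : ℕ) = x
    have hx' : ((Fin.ofNat n m : ℕ) : ℤ) < x := by omega
    rcases (Int.ediv_nonneg (show (0 : ℤ) ≤ x by omega) hn.le).eq_or_lt with h0 | h0
    · rw [← h0]
      refine hw.lower _ _ ?_
      change ((Fin.ofNat n m : ℕ)) < (x % n).toNat
      have := Int.emod_add_mul_ediv x n
      rw [← h0, mul_zero, add_zero] at this
      omega
    · exact hw.pos _ _ _ h0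
  · intro m
    rw [omegaCoeff_eq, show (m : ℤ) - (n * (m / n) : ℕ) = (Fin.ofNat n m : ℕ) by
      have := hm m; omega]
    have hlt : ((Fin.ofNat n m : ℕ) : ℤ) < n := by exact_mod_cast (Fin.ofNat n m).isLt
    rw [Int.ediv_eq_zero_of_lt (by omega) hlt, show residue n ((Fin.ofNat n m : ℕ) : ℤ) =
      Fin.ofNat n m from Fin.ext (by
        change (((Fin.ofNat n m : ℕ) : ℤ) % n).toNat = _
        rw [Int.emod_eq_of_lt (by omega) hlt, Int.toNat_natCast])]
    exact hw.diag _

/-- The difference lies in `W` and has no nonnegative Fourier modes, so injectivity of `pr₊` makes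
it zero. -/
theorem IsNormalizedFrame.eq_sum (hcell : InBigCell W) {w w₀ : Fin n → H n}
    (hw : IsNormalizedFrame W w) (hw₀ : IsNormalizedFrame W w₀)
    (h : ∀ j α, ∀ k : ℤ, 0 ≤ k →
      fourierCoeff (w₀ j : UnitAddCircle → _) k α = if j = α ∧ 0 = k then 1 else 0) (j : Fin n) :
    w j = ∑ i, fourierCoeff (w j : UnitAddCircle → _) 0 i • w₀ i := by
  rw [← sub_eq_zero]
  refine eq_zero_of_fourierCoeff hcell
    (sub_mem (hw.mem j) (sum_mem fun i _ => Submodule.smul_mem _ _ (hw₀.mem i))) ?_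
  intro α k hk
  rw [← inner_e, inner_sub_right, inner_sum]
  simp only [inner_smul_right, inner_e, h _ _ _ hk]
  rcases hk.eq_or_lt with rfl | hk
  · simp
  · rw [hw.pos j α k hk, Finset.sum_eq_zero fun i _ => by rw [if_neg (by omega), mul_zero],
      sub_zero]

theorem tauDet_eq_of_eq_sum {c c' : ℕ → ℤ → ℂ} {M : ℕ} {u : ℕ → ℕ → ℂ} (hu : ∀ j, u j j = 1)
    (hu' : ∀ k j, j < k → u k j = 0)
    (h : ∀ j < M, ∀ l, c' j l = ∑ k ∈ Finset.range M, u k j * c k l) :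
    tauDet c' M = tauDet c M := by
  have hU : (Matrix.of fun k j : Fin M => (MvPowerSeries.C (u k j) : R)).det = 1 := by
    rw [Matrix.det_of_isUpperTriangular (fun k j hkj => by
      rw [Matrix.of_apply, hu' k j hkj, map_zero])]
    exact Finset.prod_eq_one fun j _ => by rw [Matrix.of_apply, hu, map_one]
  have hmul : (Matrix.of fun i j : Fin M => expCoeff (c' j) (i : ℕ)) =
      (Matrix.of fun i j : Fin M => expCoeff (c j) (i : ℕ)) *
        Matrix.of fun k j : Fin M => (MvPowerSeries.C (u k j) : R) := by
    ext1 i j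
    rw [Matrix.mul_apply, Matrix.of_apply]
    ext d
    rw [coeff_expCoeff, h j j.isLt, Finset.sum_range, Finset.mul_sum, map_sum]
    refine Finset.sum_congr rfl fun k _ => ?_
    rw [Matrix.of_apply, Matrix.of_apply, MvPowerSeries.coeff_mul_C, coeff_expCoeff]
    ring
  rw [tauDet, hmul, Matrix.det_mul, hU, mul_one]
  rfl

theorem IsNormalizedFrame.tauN_eq_tauN [NeZero n] (hcell : InBigCell W) {w w₀ : Fin n → H n}
    (hw : IsNormalizedFrame W w) (hw₀ : IsNormalizedFrame W w₀)
    (h : ∀ j α, ∀ k : ℤ, 0 ≤ k →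
      fourierCoeff (w₀ j : UnitAddCircle → _) k α = if j = α ∧ 0 = k then 1 else 0) (N : ℕ) :
    tauN w N = tauN w₀ N := by
  have hn := NeZero.pos n
  rw [tauN_eq, tauN_eq]
  -- The block-diagonal matrix made of copies of the constant part of the frame; it is upper
  -- triangular with unit diagonal, so it has determinant `1`.
  refine tauDet_eq_of_eq_sum (u := fun k j => if k / n = j / n then
    fourierCoeff (w (Fin.ofNat n j) : UnitAddCircle → _) 0 (Fin.ofNat n k) else 0) ?_ ?_ ?_
  · intro j
    rw [if_pos rfl, hw.diag]
  · intro k j hkj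
    split_ifs with hq
    · refine hw.lower _ _ ?_
      change j % n < k % n
      have h1 := Nat.div_add_mod j n
      have h2 := Nat.div_add_mod k n
      rw [hq] at h2
      omega
    · rfl
  · intro j hj l
    rw [omegaCoeff_eq, ← inner_e]
    conv_lhs => rw [hw.eq_sum hcell hw₀ h, inner_sum]
    have hq : j / n < N := Nat.div_lt_of_lt_mul hj
    refine Finset.sum_of_injOn (fun i : Fin n => n * (j / n) + i) ?_ ?_ ?_ ?_
    · intro a _ b _ hab
      exact Fin.ext (Nat.add_left_cancel hab)
    · intro i _
      rw [Finset.mem_coe, Finset.mem_range]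
      change n * (j / n) + (i : ℕ) < n * N
      have h1 : n * (j / n + 1) ≤ n * N := Nat.mul_le_mul_left n hq
      rw [mul_add, mul_one] at h1
      have := i.isLt
      omega
    · intro k _ hk
      rw [if_neg, zero_mul]
      intro h1
      refine hk ⟨Fin.ofNat n k, Finset.mem_coe.2 (Finset.mem_univ _), ?_⟩
      dsimp only
      rw [Fin.val_ofNat, ← h1]
      exact Nat.div_add_mod k n
    · intro i _
      have h1 : (n * (j / n) + i) / n = j / n := by
        rw [Nat.mul_add_div hn, Nat.div_eq_of_lt i.isLt, add_zero]
      have h2 : Fin.ofNat n (n * (j / n) + i) = i := by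
        ext
        rw [Fin.val_ofNat, Nat.mul_add_mod, Nat.mod_eq_of_lt i.isLt]
      rw [inner_smul_right, inner_e, omegaCoeff_eq, h1, h2, if_pos rfl]

end Frames

end

end GelfandDickey

open GelfandDickey
theorem mainTheorem8 (n : ℕ) [NeZero n] (W : Submodule ℂ (H n)) (hW : IsGr W)
    (hcell : InBigCell W) :
    (∃ w : Fin n → H n, IsNormalizedFrame W w) ∧
    ∃ (τ : R) (S : PDO) (ψ : Wave) (𝓛 : PDO),
      (∀ w : Fin n → H n, IsNormalizedFrame W w →
        IsStableLimit (tauN w) τ ∧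
        PDO.IsStableLimit (SN w) S ∧
        Wave.IsStableLimit (psiN w) ψ ∧
        PDO.IsStableLimit (LaxN w) 𝓛 ∧
        PDO.IsStableLimit (fun N => LaxN w N ^ n) (𝓛 ^ n)) ∧
      S.IsMonic 0 ∧ S * S⁻¹ = 1 ∧ S⁻¹ * S = 1 ∧
      𝓛 = S * PDO.Dpow 1 * S⁻¹ ∧
      ψ = Wave.act S Wave.expXi ∧
      IsKPSolution 𝓛 ∧
      IsGelfandDickeySolution n (𝓛 ^ n) 𝓛 ∧
      IsWaveFunction n (𝓛 ^ n) 𝓛 ψ ∧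
      IsTauFunction ψ τ := by
  obtain ⟨w₀, hw₀, h₀⟩ := exists_isNormalizedFrame hcell
  refine ⟨⟨w₀, hw₀⟩, ?_⟩
  have hu := hw₀.isUnitriangular
  set τ := tauLimit (omegaCoeff w₀)
  have hS : (dressing τ).IsMonic 0 := isMonic_dressing hu
  have hev := isDiff_evolution hu
  refine ⟨τ, dressing τ, ⟨(dressing τ).coeff, (dressing τ).bdd⟩,
    dressing τ * PDO.Dpow 1 * (dressing τ)⁻¹, fun w hw => ?_, hS, hS.mul_inv, hS.inv_mul, rfl,
    (act_expXi _).symm, PDO.isKPSolution hS hev,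
    PDO.isGelfandDickeySolution hS hev (isDiff_conj_Dpow hu), PDO.isWaveFunction hS hev n,
    ⟨?_, rfl⟩⟩
  -- All frames give the same truncated objects for each `N`, so the limits need only be taken for
  -- `w₀`.
  · have hτ : tauN w = tauN w₀ := funext fun N => hw.tauN_eq_tauN hcell hw₀ h₀ N
    have hSN : SN w = SN w₀ := funext fun N => SN_eq_of_tauN_eq (congrFun hτ N)
    have hL : LaxN w = LaxN w₀ := funext fun N => by rw [LaxN, LaxN, hSN]
    rw [hτ, hSN, hL]
    refine ⟨isStableLimit_tauN hu, isStableLimit_SN hu, fun k => ?_, isStableLimit_LaxN hu,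
      (isStableLimit_LaxN hu).pow (fun N => (isMonic_SN N hu).conj 1) n⟩
    simp only [psiN, hSN, act_expXi]
    exact isStableLimit_SN hu k
  · rw [constantCoeff_tauLimit]
    exact one_ne_zero
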